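/- Let $p>2$ and $0<q<\frac{p}{p-2}$, and let $\mathbb Q=(0,1)\times(0,1)\subset\mathbb R^2$ be the open unit square. There exists a continuous map $h\colon\overline{\mathbb Q}\to\overline{\mathbb Q}$ with the following properties. 1. $h$ is onto, and it is monotone: for every continuum (nonempty compact connected set) $C\subset\overline{\mathbb Q}$, the preimage $h^{-1}(C)$ is a continuum. 2. $h$ belongs to the Sobolev class $W^{1,p}(\mathbb Q,\mathbb R^2)$ and is orientation preserving, i.e. its weak differential $Dh$ satisfies $\det Dh\ge 0$ almost everywhere in $\mathbb Q$. 3. $h$ has finite neohookean energy $$\mathsf E_q^p[h]=\int_{\mathbb Q}\Big(|Dh|^p+\frac{1}{(\det Dh)^q}\Big)\,dx<\infty,$$ where $|Dh|$ is the Hilbert–Schmidt norm, and the second term is understood as $+\infty$ where $\det Dh=0$. 4. The branch set $\mathcal B_h$, that is, the set of points $x\in\mathbb Q$ such that $h$ does not restrict to a homeomorphism onto its image on any open neighbourhood of $x$ contained in $\mathbb Q$, and its image $h(\mathcal B_h)$ both have positive Lebesgue measure. -/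

import Mathlib

/-!
The plane is modelled by `ℝ × ℝ` with Lebesgue (area) measure `volume`. Only its topology, its
measure and the directional derivatives of smooth functions are used below, so the choice of a
norm on `ℝ × ℝ` plays no role.
-/

open MeasureTheory
open scoped ENNReal ContDiff

noncomputable section

/-- The coordinate functions of a planar map. -/
def coordFun (i : Fin 2) (x : ℝ × ℝ) : ℝ := ![x.1, x.2] i

/-- The standard basis vectors `(1, 0)` and `(0, 1)` of the plane. -/
def basisVec (j : Fin 2) : ℝ × ℝ := ![((1 : ℝ), (0 : ℝ)), ((0 : ℝ), (1 : ℝ))] j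

/-- `g` is the weak (distributional) `j`-th partial derivative of the real function `f` on `X`:
both are locally integrable on `X`, and `∫_X f ∂_j φ = - ∫_X g φ` for every smooth `φ` with
compact support inside `X`. -/
def HasWeakPartialDeriv (X : Set (ℝ × ℝ)) (j : Fin 2) (f g : ℝ × ℝ → ℝ) : Prop :=
  LocallyIntegrableOn f X volume ∧ LocallyIntegrableOn g X volume ∧
    ∀ φ : ℝ × ℝ → ℝ, ContDiff ℝ ∞ φ → HasCompactSupport φ → tsupport φ ⊆ X →
      ∫ x in X, f x * fderiv ℝ φ x (basisVec j) = -∫ x in X, g x * φ x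

/-- `h` belongs to the Sobolev class `W^{1,p}(X, ℝ²)` and `Dh` is its weak differential: the
entry `Dh x i j` is the weak `j`-th partial derivative of the `i`-th coordinate of `h`, and the
coordinates of `h` and all entries of `Dh` are in `L^p(X)`. -/
structure IsSobolevMap (p : ℝ) (X : Set (ℝ × ℝ)) (h : ℝ × ℝ → ℝ × ℝ)
    (Dh : ℝ × ℝ → Matrix (Fin 2) (Fin 2) ℝ) : Prop where
  memLp : ∀ i, MemLp (fun x => coordFun i (h x)) (ENNReal.ofReal p) (volume.restrict X)
  memLp_deriv : ∀ i j, MemLp (fun x => Dh x i j) (ENNReal.ofReal p) (volume.restrict X)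
  hasWeakDeriv : ∀ i j,
    HasWeakPartialDeriv X j (fun x => coordFun i (h x)) (fun x => Dh x i j)

/-- A continuum: a (nonempty) compact connected set. -/
def IsContinuum (K : Set (ℝ × ℝ)) : Prop := IsCompact K ∧ IsConnected K

/-- `h` restricts to a continuous map of `A` onto `B` which is monotone in the sense of Morrey:
the preimage in `A` of every continuum in `B` is a continuum. -/
structure IsMonotoneOnto (A B : Set (ℝ × ℝ)) (h : ℝ × ℝ → ℝ × ℝ) : Prop where
  continuousOn : ContinuousOn h A
  image_eq : h '' A = B
  preimage_continuum : ∀ C ⊆ B, IsContinuum C → IsContinuum (A ∩ h ⁻¹' C)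

/-- The class `M^p(closure X, closure Y)` of orientation preserving monotone maps of `closure X`
onto `closure Y` in the Sobolev class `W^{1,p}(X)`; `Dh` is the weak differential of `h`. Orientation
preserving means that the Jacobian determinant is nonnegative almost everywhere. The values of `h`
outside `closure X` are irrelevant. -/
structure IsMonotoneSobolev (p : ℝ) (X Y : Set (ℝ × ℝ)) (h : ℝ × ℝ → ℝ × ℝ)
    (Dh : ℝ × ℝ → Matrix (Fin 2) (Fin 2) ℝ) : Prop where
  monotone : IsMonotoneOnto (closure X) (closure Y) h
  sobolev : IsSobolevMap p X h Dh
  det_nonneg : ∀ᵐ x ∂(volume.restrict X), 0 ≤ (Dh x).det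

/-- The Hilbert–Schmidt norm of a matrix. -/
def hilbertSchmidt (A : Matrix (Fin 2) (Fin 2) ℝ) : ℝ := Real.sqrt (∑ i, ∑ j, A i j ^ 2)

/-- The neohookean energy `∫_X (|Dh|^p + (det Dh)^(-q)) dx`, as an extended nonnegative real. For
`q > 0` the second term is `∞` at every point where `det Dh ≤ 0`. -/
def neohookeanEnergy (p q : ℝ) (X : Set (ℝ × ℝ)) (Dh : ℝ × ℝ → Matrix (Fin 2) (Fin 2) ℝ) :
    ℝ≥0∞ :=
  ∫⁻ x in X, (ENNReal.ofReal (hilbertSchmidt (Dh x) ^ p) + ENNReal.ofReal (Dh x).det ^ (-q))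

/-- The branch set: the points `x ∈ X` such that `h` is not a homeomorphism onto its image on any
open neighbourhood of `x` in `X`. -/
def branchSet (X : Set (ℝ × ℝ)) (h : ℝ × ℝ → ℝ × ℝ) : Set (ℝ × ℝ) :=
  {x ∈ X | ¬ ∃ U : Set (ℝ × ℝ), IsOpen U ∧ x ∈ U ∧ U ⊆ X ∧ Topology.IsEmbedding (U.domRestrict h)}

/-- The open unit square `(0, 1) × (0, 1)`. -/
def unitSquare : Set (ℝ × ℝ) := Set.Ioo (0 : ℝ) 1 ×ˢ Set.Ioo (0 : ℝ) 1

end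

open MeasureTheory
open scoped ENNReal ContDiff

/-! The building block is a self-map of the square `[-1, 1]²` that is the identity on the boundary
and collapses one horizontal segment to a point. Near that segment the vertical coordinate becomes
about `|y| ^ a`, with slope of order `|y| ^ (a - 1)`, and horizontal lengths shrink by a factor of
order `|y| ^ a`. Hence `|Dh| ≲ |y| ^ (a - 1)` (`abs_squeezeDeriv_le`) and `det Dh ≳ |y| ^ (2 * a -
1)` (`le_det_squeezeDeriv`). The energy is finite once `(1 - a) p < 1` and `(2 a - 1) q < 1`, and
such an `a` in `[1/2, 1)` exists precisely because `q < p / (p - 2)` (`exists_exponent`).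

Balls of the supremum norm are squares, so the block can be rescaled into any closed ball.
Conjugation by a homothety leaves the differential unchanged, so a ball of radius `r` costs `r ^ 2`
times the model energy, and disjoint balls in a bounded region have summable `r ^ 2`. Filling a
packing with such copies and taking the identity elsewhere gives a continuous map of finite energy
whose fibres are points or segments, hence a monotone map. Since the displacement vanishes on the
boundary of each ball, integration by parts holds ball by ball
(`setIntegral_closedBall_packedSqueeze`), and the glued differential is the weak one.

The packing fills, up to a null set, an open `V` that is dense in the unit square but omits a set of
positive measure. Every neighbourhood of an omitted point contains a whole collapsed segment, so
that point is a branch point (`mem_branchSet_packedSqueeze`). The map fixes all omitted points, so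
they also lie in the image of the branch set; both sets therefore have positive measure. -/

/-- The odd extension of `y ↦ y ^ a` to the real line. -/
noncomputable def oddPow (a y : ℝ) : ℝ := max y 0 ^ a - max (-y) 0 ^ a

/-- The odd piecewise affine function vanishing on `[-1/2, 1/2]` and fixing `1` and `-1`. -/
noncomputable def flatten (x : ℝ) : ℝ := 2 * max (x - 1 / 2) 0 - 2 * max (-x - 1 / 2) 0

/-- The derivative of `flatten` away from `1/2` and `-1/2`. -/
noncomputable def flattenDeriv (x : ℝ) : ℝ := if |x| ≤ 1 / 2 then 0 else 2

/-- The vertical component of the squeezing map: `oddPow a` on the line `x = 0`, the identity on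
the lines `x = 1` and `x = -1`. -/
noncomputable def squeezeSnd (a x y : ℝ) : ℝ := x ^ 2 * y + (1 - x ^ 2) * oddPow a y

/-- The horizontal component of the squeezing map, as a function of the old first coordinate and
the new second coordinate. -/
noncomputable def squeezeFst (x v : ℝ) : ℝ := |v| * x + (1 - |v|) * flatten x

/-- A map of `[-1, 1]²` which is the identity on the boundary and collapses the segment
`[-1/2, 1/2] × {0}` to the origin. -/
noncomputable def squeeze (a : ℝ) (z : ℝ × ℝ) : ℝ × ℝ :=
  (squeezeFst z.1 (squeezeSnd a z.1 z.2), squeezeSnd a z.1 z.2)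

/-- The `x`-derivative of `squeezeSnd`. -/
noncomputable def squeezeSndDx (a x y : ℝ) : ℝ := 2 * x * (y - oddPow a y)

/-- The `y`-derivative of `squeezeSnd` off the line `y = 0`. -/
noncomputable def squeezeSndDy (a x y : ℝ) : ℝ := x ^ 2 + (1 - x ^ 2) * (a * |y| ^ (a - 1))

/-- The derivative of the absolute value off the origin. -/
noncomputable def absDeriv (v : ℝ) : ℝ := if 0 < v then 1 else -1

/-- The differential of `squeeze a` off the lines `y = 0`, `x = 1/2` and `x = -1/2`. -/
noncomputable def squeezeDeriv (a : ℝ) (z : ℝ × ℝ) : Matrix (Fin 2) (Fin 2) ℝ :=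
  !![|squeezeSnd a z.1 z.2| + (1 - |squeezeSnd a z.1 z.2|) * flattenDeriv z.1
      + absDeriv (squeezeSnd a z.1 z.2) * squeezeSndDx a z.1 z.2 * (z.1 - flatten z.1),
      absDeriv (squeezeSnd a z.1 z.2) * squeezeSndDy a z.1 z.2 * (z.1 - flatten z.1);
    squeezeSndDx a z.1 z.2, squeezeSndDy a z.1 z.2]

/-! ### The model map: monotonicity, boundary values and fibres -/

theorem oddPow_of_nonneg {a y : ℝ} (ha : 0 < a) (hy : 0 ≤ y) : oddPow a y = y ^ a := by
  simp [oddPow, max_eq_left hy, max_eq_right (neg_nonpos.2 hy), Real.zero_rpow ha.ne']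

theorem oddPow_of_nonpos {a y : ℝ} (ha : 0 < a) (hy : y ≤ 0) : oddPow a y = -(-y) ^ a := by
  simp [oddPow, max_eq_right hy, max_eq_left (neg_nonneg.2 hy), Real.zero_rpow ha.ne']

theorem continuous_oddPow {a : ℝ} (ha : 0 < a) : Continuous (oddPow a) := by
  unfold oddPow
  exact ((continuous_id.max continuous_const).rpow_const fun _ => Or.inr ha.le).sub
    ((continuous_neg.max continuous_const).rpow_const fun _ => Or.inr ha.le)

theorem continuous_flatten : Continuous flatten := by
  unfold flatten
  fun_prop

theorem monotone_flatten : Monotone flatten := by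
  intro x y h
  unfold flatten
  have h1 : max (x - 1 / 2) 0 ≤ max (y - 1 / 2) 0 := max_le_max (by linarith) le_rfl
  have h2 : max (-y - 1 / 2) 0 ≤ max (-x - 1 / 2) 0 := max_le_max (by linarith) le_rfl
  linarith

theorem flatten_one : flatten 1 = 1 := by norm_num [flatten]

theorem flatten_neg_one : flatten (-1) = -1 := by norm_num [flatten]

theorem flatten_of_abs_le {x : ℝ} (h : |x| ≤ 1 / 2) : flatten x = 0 := by
  obtain ⟨h1, h2⟩ := abs_le.1 h
  simp only [flatten]
  rw [max_eq_right (by linarith), max_eq_right (by linarith)]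
  ring

theorem flatten_of_ge {x : ℝ} (h : 1 / 2 ≤ x) : flatten x = 2 * x - 1 := by
  simp only [flatten]
  rw [max_eq_left (by linarith), max_eq_right (by linarith)]
  ring

theorem flatten_of_le {x : ℝ} (h : x ≤ -(1 / 2)) : flatten x = 2 * x + 1 := by
  simp only [flatten]
  rw [max_eq_right (by linarith), max_eq_left (by linarith)]
  ring

theorem abs_sub_flatten_le {x : ℝ} (hx : |x| ≤ 1) : |x - flatten x| ≤ 1 := by
  obtain ⟨h1, h2⟩ := abs_le.1 hx
  rcases le_total |x| (1 / 2) with h | h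
  · rw [flatten_of_abs_le h]
    simpa using hx
  · rw [abs_le]
    rcases le_abs'.1 h with h | h
    · rw [flatten_of_le h]; constructor <;> linarith
    · rw [flatten_of_ge h]; constructor <;> linarith

/-- Outside the plateau `[-1/2, 1/2]` the slope is 2, so only points of the plateau can share a
value. -/
theorem bounds_of_flatten_eq {x y : ℝ} (hxy : x < y) (h : flatten x = flatten y) :
    -(1 / 2) ≤ x ∧ y ≤ 1 / 2 := by
  have h0 : flatten (1 / 2) = 0 := flatten_of_abs_le (abs_of_pos (by norm_num)).le
  have h0' : flatten (-(1 / 2)) = 0 := flatten_of_abs_le (by rw [abs_neg]; exact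
    (abs_of_pos (by norm_num)).le)
  constructor <;> by_contra! hlt
  · rw [flatten_of_le hlt.le] at h
    rcases le_total y (-(1 / 2)) with hy | hy
    · rw [flatten_of_le hy] at h; linarith
    · have := monotone_flatten hy; linarith
  · rw [flatten_of_ge hlt.le] at h
    rcases le_total (1 / 2) x with hx | hx
    · rw [flatten_of_ge hx] at h; linarith
    · have := monotone_flatten hx; linarith

theorem eq_or_abs_le_of_flatten_eq {x y : ℝ} (h : flatten x = flatten y) :
    x = y ∨ |x| ≤ 1 / 2 ∧ |y| ≤ 1 / 2 := by
  simp only [abs_le]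
  rcases lt_trichotomy x y with hxy | hxy | hxy
  · obtain ⟨h1, h2⟩ := bounds_of_flatten_eq hxy h
    exact Or.inr ⟨⟨h1, by linarith⟩, ⟨by linarith, h2⟩⟩
  · exact Or.inl hxy
  · obtain ⟨h1, h2⟩ := bounds_of_flatten_eq hxy h.symm
    exact Or.inr ⟨⟨by linarith, h2⟩, ⟨h1, by linarith⟩⟩

theorem oddPow_zero {a : ℝ} : oddPow a 0 = 0 := by simp [oddPow]

theorem oddPow_one {a : ℝ} (ha : 0 < a) : oddPow a 1 = 1 := by
  simp [oddPow_of_nonneg ha]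

theorem oddPow_neg_one {a : ℝ} (ha : 0 < a) : oddPow a (-1) = -1 := by
  simp [oddPow_of_nonpos ha]

theorem strictMono_oddPow {a : ℝ} (ha : 0 < a) : StrictMono (oddPow a) := by
  intro x y h
  rcases le_total 0 x with hx | hx
  · rw [oddPow_of_nonneg ha hx, oddPow_of_nonneg ha (hx.trans h.le)]
    exact Real.rpow_lt_rpow hx h ha
  · rw [oddPow_of_nonpos ha hx]
    rcases le_or_gt y 0 with hy | hy
    · rw [oddPow_of_nonpos ha hy]
      exact neg_lt_neg (Real.rpow_lt_rpow (by linarith) (by linarith) ha)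
    · rw [oddPow_of_nonneg ha hy.le]
      have := Real.rpow_nonneg (neg_nonneg.2 hx) a
      have := Real.rpow_pos_of_pos hy a
      linarith

theorem sq_le_one_of_abs {x : ℝ} (hx : |x| ≤ 1) : x ^ 2 ≤ 1 := (sq_le_one_iff_abs_le_one x).2 hx

theorem strictMono_squeezeSnd {a x : ℝ} (ha : 0 < a) (hx : |x| ≤ 1) :
    StrictMono (squeezeSnd a x) := by
  intro y y' h
  have h1 := strictMono_oddPow ha h
  have h2 := sq_le_one_of_abs hx
  have h3 := sq_nonneg x
  unfold squeezeSnd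
  rcases h2.lt_or_eq with h2 | h2
  · nlinarith [mul_le_mul_of_nonneg_left h.le h3, mul_lt_mul_of_pos_left h1 (sub_pos.2 h2)]
  · rw [h2]; linarith

/-- `y` and `oddPow a y` have the same sign, so there is no cancellation in the convex combination.
-/
theorem abs_squeezeSnd {a x : ℝ} (ha : 0 < a) (hx : |x| ≤ 1) (y : ℝ) :
    |squeezeSnd a x y| = x ^ 2 * |y| + (1 - x ^ 2) * |y| ^ a := by
  have h2 := sub_nonneg.2 (sq_le_one_of_abs hx)
  have h3 := sq_nonneg x
  unfold squeezeSnd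
  rcases le_total 0 y with hy | hy
  · rw [oddPow_of_nonneg ha hy, abs_of_nonneg hy, abs_of_nonneg]
    positivity
  · have := neg_nonneg.2 hy
    rw [oddPow_of_nonpos ha hy, abs_of_nonpos hy, ← abs_neg, abs_of_nonneg]
    · ring
    · have : 0 ≤ x ^ 2 * (-y) + (1 - x ^ 2) * (-y) ^ a := by positivity
      linarith

theorem squeezeSnd_zero {a x : ℝ} : squeezeSnd a x 0 = 0 := by
  simp [squeezeSnd, oddPow_zero]

theorem squeezeSnd_one {a : ℝ} (ha : 0 < a) (x : ℝ) : squeezeSnd a x 1 = 1 := by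
  simp [squeezeSnd, oddPow_one ha]

theorem squeezeSnd_neg_one {a : ℝ} (ha : 0 < a) (x : ℝ) : squeezeSnd a x (-1) = -1 := by
  rw [squeezeSnd, oddPow_neg_one ha]; ring

theorem abs_squeezeSnd_le_one {a x y : ℝ} (ha : 0 < a) (hx : |x| ≤ 1) (hy : |y| ≤ 1) :
    |squeezeSnd a x y| ≤ 1 := by
  obtain ⟨h1, h2⟩ := abs_le.1 hy
  have hm := (strictMono_squeezeSnd ha hx).monotone
  exact abs_le.2 ⟨(squeezeSnd_neg_one ha x).symm.trans_le (hm h1),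
    (hm h2).trans_eq (squeezeSnd_one ha x)⟩

theorem abs_flatten_le_one {x : ℝ} (hx : |x| ≤ 1) : |flatten x| ≤ 1 := by
  obtain ⟨h1, h2⟩ := abs_le.1 hx
  exact abs_le.2 ⟨flatten_neg_one.symm.trans_le (monotone_flatten h1),
    (monotone_flatten h2).trans_eq flatten_one⟩

theorem abs_squeezeFst_le_one {x v : ℝ} (hx : |x| ≤ 1) (hv : |v| ≤ 1) :
    |squeezeFst x v| ≤ 1 := by
  have h1 := abs_le.1 hx
  have h2 := abs_le.1 (abs_flatten_le_one hx)
  have h3 := abs_nonneg v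
  unfold squeezeFst
  rw [abs_le]
  constructor <;> nlinarith

theorem strictMono_squeezeFst {v : ℝ} (h0 : v ≠ 0) (hv : |v| ≤ 1) :
    StrictMono fun x => squeezeFst x v := by
  intro x x' h
  have h1 := monotone_flatten h.le
  have h2 := abs_pos.2 h0
  simp only [squeezeFst]
  nlinarith [mul_le_mul_of_nonneg_left h1 (sub_nonneg.2 hv), mul_lt_mul_of_pos_left h h2]

theorem squeezeFst_one (v : ℝ) : squeezeFst 1 v = 1 := by simp [squeezeFst, flatten_one]

theorem squeezeFst_neg_one (v : ℝ) : squeezeFst (-1) v = -1 := by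
  rw [squeezeFst, flatten_neg_one]; ring

theorem continuous_squeezeSnd {a : ℝ} (ha : 0 < a) :
    Continuous fun z : ℝ × ℝ => squeezeSnd a z.1 z.2 := by
  unfold squeezeSnd
  have := continuous_oddPow ha
  fun_prop

theorem continuous_squeezeFst : Continuous fun z : ℝ × ℝ => squeezeFst z.1 z.2 := by
  unfold squeezeFst
  have := continuous_flatten
  fun_prop

theorem continuous_squeeze {a : ℝ} (ha : 0 < a) : Continuous (squeeze a) := by
  have h := continuous_squeezeSnd ha
  exact (continuous_squeezeFst.comp (continuous_fst.prodMk h)).prodMk h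

theorem mem_unitBall_iff {z : ℝ × ℝ} :
    z ∈ Metric.closedBall (0 : ℝ × ℝ) 1 ↔ |z.1| ≤ 1 ∧ |z.2| ≤ 1 := by
  simp [Prod.norm_def]

theorem squeeze_mapsTo {a : ℝ} (ha : 0 < a) :
    Set.MapsTo (squeeze a) (Metric.closedBall 0 1) (Metric.closedBall 0 1) := by
  intro z hz
  rw [mem_unitBall_iff] at hz ⊢
  have := abs_squeezeSnd_le_one ha hz.1 hz.2
  exact ⟨abs_squeezeFst_le_one hz.1 this, this⟩

theorem squeeze_surjOn {a : ℝ} (ha : 0 < a) :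
    Set.SurjOn (squeeze a) (Metric.closedBall 0 1) (Metric.closedBall 0 1) := by
  rintro ⟨u, v⟩ hz
  rw [mem_unitBall_iff, abs_le, abs_le] at hz
  have hF : Continuous fun x => squeezeFst x v :=
    continuous_squeezeFst.comp (continuous_id.prodMk continuous_const)
  -- The second output `v` is already known, so `x` is found first from the horizontal equation at
  -- height `v`, and then `y` on the vertical line through `x`.
  obtain ⟨x, hx, hxu⟩ := intermediate_value_Icc (by norm_num : (-1 : ℝ) ≤ 1) hF.continuousOn
    (by simpa only [squeezeFst_one, squeezeFst_neg_one, Set.mem_Icc] using hz.1)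
  have hG : Continuous fun y => squeezeSnd a x y :=
    (continuous_squeezeSnd ha).comp (continuous_const.prodMk continuous_id)
  obtain ⟨y, hy, hyv⟩ := intermediate_value_Icc (by norm_num : (-1 : ℝ) ≤ 1) hG.continuousOn
    (by simpa only [squeezeSnd_one ha, squeezeSnd_neg_one ha, Set.mem_Icc] using hz.2)
  refine ⟨(x, y), mem_unitBall_iff.2 ⟨abs_le.2 hx, abs_le.2 hy⟩, ?_⟩
  simp only at hxu hyv
  simp only [squeeze, hyv, hxu]

/-- The segment collapsed by `squeeze`. -/
def collapsedSegment : Set (ℝ × ℝ) := Set.Icc (-(1 / 2)) (1 / 2) ×ˢ {0}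

theorem squeeze_of_mem_collapsedSegment {a : ℝ} {z : ℝ × ℝ} (hz : z ∈ collapsedSegment) :
    squeeze a z = 0 := by
  obtain ⟨x, y⟩ := z
  obtain ⟨hx, hy⟩ := hz
  simp only [Set.mem_singleton_iff] at hx hy
  subst hy
  simp [squeeze, squeezeSnd_zero, squeezeFst, flatten_of_abs_le (abs_le.2 hx)]

theorem collapsedSegment_subset : collapsedSegment ⊆ Metric.closedBall 0 1 := by
  rintro ⟨x, y⟩ ⟨hx, hy⟩
  simp only [Set.mem_singleton_iff, Set.mem_Icc] at hx hy
  subst hy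
  exact mem_unitBall_iff.2 ⟨abs_le.2 ⟨by linarith, by linarith⟩, by simp⟩

/-- The second output vanishes only on `y = 0`, where the first reduces to `flatten`. At any other
height the first output is strictly increasing in `x`, and then the second determines `y`. -/
theorem eq_or_mem_collapsedSegment {a : ℝ} (ha : 0 < a) {z w : ℝ × ℝ}
    (hz : z ∈ Metric.closedBall 0 1) (hw : w ∈ Metric.closedBall 0 1)
    (h : squeeze a z = squeeze a w) :
    z = w ∨ z ∈ collapsedSegment ∧ w ∈ collapsedSegment := by
  obtain ⟨x, y⟩ := z
  obtain ⟨x', y'⟩ := w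
  rw [mem_unitBall_iff] at hz hw
  simp only [squeeze, Prod.mk.injEq] at h hz hw
  obtain ⟨h1, h2⟩ := h
  rw [← h2] at h1
  by_cases h0 : squeezeSnd a x y = 0
  · have hy : y = 0 := (strictMono_squeezeSnd ha hz.1).injective (h0.trans squeezeSnd_zero.symm)
    have hy' : y' = 0 :=
      (strictMono_squeezeSnd ha hw.1).injective ((h2.symm.trans h0).trans squeezeSnd_zero.symm)
    subst hy hy'
    simp only [h0, squeezeFst, abs_zero, zero_mul, zero_add, sub_zero, one_mul] at h1
    rcases eq_or_abs_le_of_flatten_eq h1 with h | ⟨h, h'⟩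
    · exact Or.inl (by rw [h])
    · exact Or.inr ⟨⟨abs_le.1 h, rfl⟩, ⟨abs_le.1 h', rfl⟩⟩
  · have hx : x = x' :=
      (strictMono_squeezeFst h0 (abs_squeezeSnd_le_one ha hz.1 hz.2)).injective h1
    subst hx
    exact Or.inl (by rw [(strictMono_squeezeSnd ha hz.1).injective h2])

theorem squeeze_of_abs_fst_eq_one {a : ℝ} {z : ℝ × ℝ} (h : |z.1| = 1) : squeeze a z = z := by
  have h2 : z.1 ^ 2 = 1 := by rw [← sq_abs, h]; norm_num
  have h3 : squeezeSnd a z.1 z.2 = z.2 := by simp [squeezeSnd, h2]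
  ext
  · rcases eq_or_eq_neg_of_abs_eq h with h | h <;>
      simp [squeeze, h, squeezeFst_one, squeezeFst_neg_one]
  · exact h3

theorem squeeze_of_abs_snd_eq_one {a : ℝ} (ha : 0 < a) {z : ℝ × ℝ} (h : |z.2| = 1) :
    squeeze a z = z := by
  have h3 : squeezeSnd a z.1 z.2 = z.2 := by
    rcases eq_or_eq_neg_of_abs_eq h with h | h <;>
      simp [h, squeezeSnd_one ha, squeezeSnd_neg_one ha]
  ext
  · simp [squeeze, h3, squeezeFst, h]
  · exact h3

/-! ### Derivatives of the model map and pointwise bounds -/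

theorem hasDerivAt_oddPow {a y : ℝ} (ha : 0 < a) (hy : y ≠ 0) :
    HasDerivAt (oddPow a) (a * |y| ^ (a - 1)) y := by
  rcases hy.lt_or_gt with hy | hy
  · have h : HasDerivAt (fun s : ℝ => -(-s) ^ a) (a * |y| ^ (a - 1)) y := by
      have := ((hasDerivAt_id y).fun_neg.rpow_const (p := a) (Or.inl (by simp [hy.ne]))).fun_neg
      refine this.congr_deriv ?_
      simp [abs_of_neg hy]
    refine h.congr_of_eventuallyEq ?_
    filter_upwards [Iio_mem_nhds hy] with s hs
    exact oddPow_of_nonpos ha (le_of_lt hs)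
  · have h : HasDerivAt (fun s : ℝ => s ^ a) (a * |y| ^ (a - 1)) y := by
      rw [abs_of_pos hy]
      exact Real.hasDerivAt_rpow_const (Or.inl hy.ne')
    refine h.congr_of_eventuallyEq ?_
    filter_upwards [Ioi_mem_nhds hy] with s hs
    exact oddPow_of_nonneg ha (le_of_lt hs)

theorem hasDerivAt_flatten {x : ℝ} (h1 : x ≠ 1 / 2) (h2 : x ≠ -(1 / 2)) :
    HasDerivAt flatten (flattenDeriv x) x := by
  unfold flattenDeriv
  rcases h2.lt_or_gt with h2 | h2
  · rw [if_neg (by rw [abs_le]; rintro ⟨h, -⟩; linarith)]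
    have : HasDerivAt (fun s : ℝ => 2 * s + 1) 2 x := by
      simpa using ((hasDerivAt_id x).const_mul 2).add_const 1
    refine this.congr_of_eventuallyEq ?_
    filter_upwards [Iio_mem_nhds h2] with s hs
    exact flatten_of_le (le_of_lt hs)
  · rcases h1.lt_or_gt with h1 | h1
    · rw [if_pos (abs_le.2 ⟨h2.le, h1.le⟩)]
      refine (hasDerivAt_const x (0 : ℝ)).congr_of_eventuallyEq ?_
      filter_upwards [Ioo_mem_nhds h2 h1] with s hs
      exact flatten_of_abs_le (abs_le.2 ⟨hs.1.le, hs.2.le⟩)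
    · rw [if_neg (by rw [abs_le]; rintro ⟨-, h⟩; linarith)]
      have : HasDerivAt (fun s : ℝ => 2 * s - 1) 2 x := by
        simpa using ((hasDerivAt_id x).const_mul 2).sub_const 1
      refine this.congr_of_eventuallyEq ?_
      filter_upwards [Ioi_mem_nhds h1] with s hs
      exact flatten_of_ge (le_of_lt hs)

theorem hasDerivAt_abs_absDeriv {v : ℝ} (hv : v ≠ 0) : HasDerivAt (|·|) (absDeriv v) v := by
  unfold absDeriv
  rcases hv.lt_or_gt with h | h
  · rw [if_neg h.not_gt]; exact hasDerivAt_abs_neg h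
  · rw [if_pos h]; exact hasDerivAt_abs_pos h

theorem squeezeSnd_ne_zero {a x y : ℝ} (ha : 0 < a) (hx : |x| ≤ 1) (hy : y ≠ 0) :
    squeezeSnd a x y ≠ 0 := fun h =>
  hy ((strictMono_squeezeSnd ha hx).injective (h.trans squeezeSnd_zero.symm))

theorem hasDerivAt_squeezeSnd_fst (a x y : ℝ) :
    HasDerivAt (fun s => squeezeSnd a s y) (squeezeSndDx a x y) x := by
  have h : HasDerivAt (fun s : ℝ => s ^ 2) (2 * x) x := by simpa using hasDerivAt_pow 2 x
  have := (h.mul_const y).fun_add ((h.const_sub 1).mul_const (oddPow a y))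
  refine this.congr_deriv ?_
  simp only [squeezeSndDx]; ring

theorem hasDerivAt_squeezeSnd_snd {a y : ℝ} (ha : 0 < a) (x : ℝ) (hy : y ≠ 0) :
    HasDerivAt (fun s => squeezeSnd a x s) (squeezeSndDy a x y) y := by
  have := ((hasDerivAt_id y).const_mul (x ^ 2)).fun_add
    ((hasDerivAt_oddPow ha hy).const_mul (1 - x ^ 2))
  refine this.congr_deriv ?_
  simp only [squeezeSndDy]; ring

theorem hasDerivAt_squeeze_fst {a x y : ℝ} (ha : 0 < a) (hx : |x| ≤ 1) (hy : y ≠ 0)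
    (h1 : x ≠ 1 / 2) (h2 : x ≠ -(1 / 2)) (i : Fin 2) :
    HasDerivAt (fun s => coordFun i (squeeze a (s, y))) (squeezeDeriv a (x, y) i 0) x := by
  have hG := hasDerivAt_squeezeSnd_fst a x y
  fin_cases i
  · have hA := (hasDerivAt_abs_absDeriv (squeezeSnd_ne_zero ha hx hy)).comp x hG
    have := (hA.fun_mul (hasDerivAt_id x)).fun_add
      ((hA.const_sub 1).fun_mul (hasDerivAt_flatten h1 h2))
    refine this.congr_deriv ?_
    simp [squeezeDeriv]; ring
  · exact hG

theorem hasDerivAt_squeeze_snd {a x y : ℝ} (ha : 0 < a) (hx : |x| ≤ 1) (hy : y ≠ 0) (i : Fin 2) :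
    HasDerivAt (fun s => coordFun i (squeeze a (x, s))) (squeezeDeriv a (x, y) i 1) y := by
  have hG := hasDerivAt_squeezeSnd_snd ha x hy
  fin_cases i
  · have hA := (hasDerivAt_abs_absDeriv (squeezeSnd_ne_zero ha hx hy)).comp y hG
    have := (hA.mul_const x).fun_add ((hA.const_sub 1).mul_const (flatten x))
    refine this.congr_deriv ?_
    simp [squeezeDeriv]; ring
  · exact hG

/-- The map factors as `(x, y) ↦ (x, v) ↦ (squeezeFst x v, v)`, each factor moving one coordinate,
so the Jacobian is a product and the `absDeriv` terms cancel. -/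
theorem det_squeezeDeriv (a : ℝ) (z : ℝ × ℝ) : (squeezeDeriv a z).det =
    (|squeezeSnd a z.1 z.2| + (1 - |squeezeSnd a z.1 z.2|) * flattenDeriv z.1)
      * squeezeSndDy a z.1 z.2 := by
  simp [squeezeDeriv, Matrix.det_fin_two]; ring

theorem one_le_abs_rpow {y s : ℝ} (h0 : y ≠ 0) (hy : |y| ≤ 1) (hs : s ≤ 0) : 1 ≤ |y| ^ s :=
  Real.one_le_rpow_of_pos_of_le_one_of_nonpos (abs_pos.2 h0) hy hs

/-- Over the plateau the horizontal stretch is `|v|`, of order `|y| ^ a`, and the vertical one is of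
order `|y| ^ (a - 1)`. Away from it both factors are bounded below, and `1 / 2 ≤ a` makes the
claimed bound at most `a / 2`. -/
theorem le_det_squeezeDeriv {a : ℝ} (ha : 1 / 2 ≤ a) (ha' : a < 1) {z : ℝ × ℝ}
    (hx : |z.1| ≤ 1) (hy : |z.2| ≤ 1) (h0 : z.2 ≠ 0) :
    a / 2 * |z.2| ^ (2 * a - 1) ≤ (squeezeDeriv a z).det := by
  obtain ⟨x, y⟩ := z
  simp only at hx hy h0
  have ha0 : 0 < a := by linarith
  have hG := abs_squeezeSnd_le_one ha0 hx hy
  have hG0 := abs_nonneg (squeezeSnd a x y)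
  rw [det_squeezeDeriv]
  simp only
  have hx2 := sq_le_one_of_abs hx
  have hP1 : 1 ≤ |y| ^ (a - 1) := one_le_abs_rpow h0 hy (by linarith)
  have hQ0 : 0 ≤ |y| ^ a := by positivity
  have hprod : |y| ^ (2 * a - 1) = |y| ^ a * |y| ^ (a - 1) := by
    rw [← Real.rpow_add (abs_pos.2 h0)]; ring_nf
  by_cases hxs : |x| ≤ 1 / 2
  -- The weight `1 - x ^ 2` is at least `3 / 4` in both factors, and `(3 / 4) ^ 2 ≥ 1 / 2`.
  · have hx4 : x ^ 2 ≤ 1 / 4 := by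
      rw [← sq_abs]; nlinarith [abs_nonneg x]
    rw [flattenDeriv, if_pos hxs, mul_zero, add_zero, abs_squeezeSnd ha0 hx, squeezeSndDy, hprod]
    have hA : 3 / 4 * |y| ^ a ≤ x ^ 2 * |y| + (1 - x ^ 2) * |y| ^ a := by
      have : 0 ≤ x ^ 2 * |y| := by positivity
      nlinarith
    have hP : 3 / 4 * (a * |y| ^ (a - 1)) ≤ x ^ 2 + (1 - x ^ 2) * (a * |y| ^ (a - 1)) := by
      have : 0 ≤ a * |y| ^ (a - 1) := by positivity
      nlinarith [sq_nonneg x]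
    have h := mul_le_mul hA hP (by positivity) (le_trans (by positivity) hA)
    have : 0 ≤ a * (|y| ^ a * |y| ^ (a - 1)) := by positivity
    nlinarith
  · rw [flattenDeriv, if_neg hxs, squeezeSndDy]
    have hP : a ≤ x ^ 2 + (1 - x ^ 2) * (a * |y| ^ (a - 1)) := by
      have : a ≤ a * |y| ^ (a - 1) := le_mul_of_one_le_right ha0.le hP1
      nlinarith [mul_le_mul_of_nonneg_left this (sub_nonneg.2 hx2), sq_nonneg x]
    have h1 : |y| ^ (2 * a - 1) ≤ 1 := Real.rpow_le_one (abs_nonneg y) hy (by linarith)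
    have h2 : 1 ≤ |squeezeSnd a x y| + (1 - |squeezeSnd a x y|) * 2 := by linarith
    calc a / 2 * |y| ^ (2 * a - 1) ≤ a / 2 * 1 := by gcongr
      _ ≤ 1 * a := by linarith
      _ ≤ _ := mul_le_mul h2 hP ha0.le (by linarith)

theorem abs_squeezeDeriv_le {a : ℝ} (ha : 0 < a) (ha' : a < 1) {z : ℝ × ℝ}
    (hx : |z.1| ≤ 1) (hy : |z.2| ≤ 1) (h0 : z.2 ≠ 0) (i j : Fin 2) :
    |squeezeDeriv a z i j| ≤ 7 * |z.2| ^ (a - 1) := by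
  obtain ⟨x, y⟩ := z
  simp only at hx hy h0
  have hG := abs_squeezeSnd_le_one ha hx hy
  have hG0 := abs_nonneg (squeezeSnd a x y)
  have hx2 := sq_le_one_of_abs hx
  have hP1 : 1 ≤ |y| ^ (a - 1) := one_le_abs_rpow h0 hy (by linarith)
  have hs : |absDeriv (squeezeSnd a x y)| ≤ 1 := by unfold absDeriv; split_ifs <;> simp
  have hk := abs_sub_flatten_le hx
  have hDx : |squeezeSndDx a x y| ≤ 4 := by
    have hg : |oddPow a y| ≤ 1 := by
      -- On the line `x = 0` the vertical component is exactly `oddPow a`.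
      have := abs_squeezeSnd_le_one ha (x := 0) (by simp) hy
      simpa [squeezeSnd] using this
    rw [squeezeSndDx, abs_mul, abs_mul, abs_two]
    have := abs_sub y (oddPow a y)
    nlinarith [abs_nonneg x, abs_nonneg (y - oddPow a y)]
  have hDy : |squeezeSndDy a x y| ≤ 2 * |y| ^ (a - 1) := by
    rw [squeezeSndDy, abs_of_nonneg
      (add_nonneg (sq_nonneg x) (mul_nonneg (sub_nonneg.2 hx2) (by positivity)))]
    have : a * |y| ^ (a - 1) ≤ |y| ^ (a - 1) := mul_le_of_le_one_left (by positivity) ha'.le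
    nlinarith [mul_le_mul_of_nonneg_left this (sub_nonneg.2 hx2), sq_nonneg x]
  have hmul : ∀ {D C : ℝ}, |D| ≤ C →
      |absDeriv (squeezeSnd a x y) * D * (x - flatten x)| ≤ C := by
    intro D C hD
    rw [abs_mul, abs_mul]
    calc _ ≤ 1 * C * 1 := mul_le_mul (mul_le_mul hs hD (abs_nonneg _) zero_le_one) hk
          (abs_nonneg _) (by linarith [abs_nonneg D])
      _ = C := by ring
  fin_cases i <;> fin_cases j
  · have h1 := abs_le.1 (hmul hDx)
    have h2 : 0 ≤ flattenDeriv x ∧ flattenDeriv x ≤ 2 := by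
      unfold flattenDeriv; split_ifs <;> norm_num
    simp only [squeezeDeriv, Matrix.of_apply, Matrix.cons_val', Matrix.cons_val_zero, Fin.zero_eta,
      Matrix.cons_val_fin_one]
    rw [abs_le]
    constructor <;> nlinarith [mul_nonneg (sub_nonneg.2 hG) h2.1]
  · have := hmul hDy
    simp only [squeezeDeriv, Matrix.of_apply, Matrix.cons_val', Matrix.cons_val_zero, Fin.zero_eta,
      Matrix.cons_val_fin_one, Fin.mk_one, Matrix.cons_val_one]
    linarith
  · simp only [squeezeDeriv, Matrix.of_apply, Matrix.cons_val', Matrix.cons_val_zero, Fin.zero_eta,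
      Matrix.cons_val_fin_one, Fin.mk_one, Matrix.cons_val_one]
    linarith
  · simp only [squeezeDeriv, Matrix.of_apply, Matrix.cons_val', Matrix.cons_val_fin_one,
      Fin.mk_one, Matrix.cons_val_one]
    linarith

theorem measurable_squeezeDeriv {a : ℝ} (ha : 0 < a) (i j : Fin 2) :
    Measurable fun z => squeezeDeriv a z i j := by
  have hG := (continuous_squeezeSnd ha).measurable
  have hk := continuous_flatten.measurable
  have hg := (continuous_oddPow ha).measurable
  have hs : Measurable absDeriv := Measurable.ite measurableSet_Ioi measurable_const measurable_const
  have hk' : Measurable flattenDeriv :=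
    Measurable.ite (measurableSet_le measurable_id.abs measurable_const) measurable_const
      measurable_const
  have hDx : Measurable fun z : ℝ × ℝ => squeezeSndDx a z.1 z.2 := by
    unfold squeezeSndDx; fun_prop
  have hDy : Measurable fun z : ℝ × ℝ => squeezeSndDy a z.1 z.2 := by
    unfold squeezeSndDy; fun_prop
  fin_cases i <;> fin_cases j <;>
    simp only [squeezeDeriv, Matrix.of_apply, Matrix.cons_val', Matrix.cons_val_zero, Fin.zero_eta,
      Matrix.cons_val_fin_one, Fin.mk_one, Matrix.cons_val_one] <;> fun_prop

/-! ### Finite energy of the model map -/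

theorem unitBall_eq_prod : Metric.closedBall (0 : ℝ × ℝ) 1 = Set.Icc (-1) 1 ×ˢ Set.Icc (-1) 1 := by
  ext z
  rw [mem_unitBall_iff, abs_le, abs_le]; rfl

theorem restrict_unitBall : volume.restrict (Metric.closedBall (0 : ℝ × ℝ) 1) =
    (volume.restrict (Set.Icc (-1 : ℝ) 1)).prod (volume.restrict (Set.Icc (-1 : ℝ) 1)) := by
  rw [unitBall_eq_prod, Measure.volume_eq_prod, Measure.prod_restrict]

theorem lintegral_abs_rpow_lt_top {s : ℝ} (hs : -1 < s) :
    ∫⁻ y in Set.Icc (-1 : ℝ) 1, ENNReal.ofReal (|y| ^ s) < ⊤ := by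
  have h0 : IntervalIntegrable (fun y : ℝ => |y| ^ s) volume 0 1 := by
    refine (intervalIntegral.intervalIntegrable_rpow' hs (a := 0) (b := 1)).congr ?_
    intro y hy
    rw [Set.uIoc_of_le zero_le_one] at hy
    simp [abs_of_pos hy.1]
  have h1 : IntervalIntegrable (fun y : ℝ => |y| ^ s) volume (-1) 0 := by
    have := ((IntervalIntegrable.iff_comp_neg).1 h0).symm
    simpa using this
  have h2 := (intervalIntegrable_iff_integrableOn_Icc_of_le (by norm_num)).1 (h1.trans h0)
  have := h2.2
  rw [hasFiniteIntegral_iff_ofReal] at this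
  · exact this
  · exact Filter.Eventually.of_forall fun y => by positivity

theorem lintegral_unitBall_abs_snd_rpow_lt_top {s : ℝ} (hs : -1 < s) :
    ∫⁻ z in Metric.closedBall (0 : ℝ × ℝ) 1, ENNReal.ofReal (|z.2| ^ s) < ⊤ := by
  rw [restrict_unitBall, lintegral_prod _ (by fun_prop)]
  simp only [lintegral_const]
  exact ENNReal.mul_lt_top (lintegral_abs_rpow_lt_top hs) (by simp)

theorem ae_snd_ne_zero : ∀ᵐ z : ℝ × ℝ, z.2 ≠ 0 := by
  rw [Measure.volume_eq_prod]
  exact (Measure.quasiMeasurePreserving_snd (μ := (volume : Measure ℝ))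
    (ν := (volume : Measure ℝ))).ae (Measure.ae_ne volume 0)

theorem abs_le_hilbertSchmidt (A : Matrix (Fin 2) (Fin 2) ℝ) (i j : Fin 2) :
    |A i j| ≤ hilbertSchmidt A := by
  refine Real.abs_le_sqrt ?_
  calc A i j ^ 2 ≤ ∑ l, A i l ^ 2 :=
        Finset.single_le_sum (f := fun l => A i l ^ 2) (fun _ _ => sq_nonneg _) (Finset.mem_univ j)
    _ ≤ _ := Finset.single_le_sum (f := fun k => ∑ l, A k l ^ 2)
        (fun _ _ => Finset.sum_nonneg fun _ _ => sq_nonneg _) (Finset.mem_univ i)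

theorem hilbertSchmidt_le {A : Matrix (Fin 2) (Fin 2) ℝ} {C : ℝ} (hC : 0 ≤ C)
    (h : ∀ i j, |A i j| ≤ C) : hilbertSchmidt A ≤ 2 * C := by
  refine Real.sqrt_le_iff.2 ⟨by positivity, ?_⟩
  have h2 : ∀ i j, A i j ^ 2 ≤ C ^ 2 := fun i j => sq_le_sq' (abs_le.1 (h i j)).1 (abs_le.1 (h i j)).2
  simp only [Fin.sum_univ_two]
  nlinarith [h2 0 0, h2 0 1, h2 1 0, h2 1 1]

theorem neohookeanEnergy_squeezeDeriv_lt_top {p q a : ℝ} (hp : 0 < p) (hq : 0 < q)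
    (ha : 1 / 2 ≤ a) (ha' : a < 1) (hap : -1 < (a - 1) * p) (haq : -1 < (2 * a - 1) * -q) :
    neohookeanEnergy p q (Metric.closedBall 0 1) (squeezeDeriv a) < ⊤ := by
  have ha0 : 0 < a := by linarith
  have hbound : ∀ᵐ z ∂volume.restrict (Metric.closedBall (0 : ℝ × ℝ) 1),
      ENNReal.ofReal (hilbertSchmidt (squeezeDeriv a z) ^ p)
        + ENNReal.ofReal (squeezeDeriv a z).det ^ (-q) ≤
      ENNReal.ofReal (14 ^ p) * ENNReal.ofReal (|z.2| ^ ((a - 1) * p))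
        + ENNReal.ofReal ((a / 2) ^ (-q)) * ENNReal.ofReal (|z.2| ^ ((2 * a - 1) * -q)) := by
    filter_upwards [ae_restrict_mem Metric.isClosed_closedBall.measurableSet,
      ae_restrict_of_ae ae_snd_ne_zero] with z hz h0
    rw [mem_unitBall_iff] at hz
    have hy := abs_pos.2 h0
    gcongr
    · rw [← ENNReal.ofReal_mul (by positivity), Real.rpow_mul hy.le,
        ← Real.mul_rpow (by norm_num) (by positivity)]
      refine ENNReal.ofReal_le_ofReal (Real.rpow_le_rpow (Real.sqrt_nonneg _) ?_ hp.le)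
      refine (hilbertSchmidt_le (by positivity)
        (abs_squeezeDeriv_le ha0 ha' hz.1 hz.2 h0)).trans_eq ?_
      ring
    · have hpos : 0 < a / 2 * |z.2| ^ (2 * a - 1) := by positivity
      rw [← ENNReal.ofReal_mul (by positivity), Real.rpow_mul hy.le,
        ← Real.mul_rpow (by positivity) (by positivity), ← ENNReal.ofReal_rpow_of_pos hpos]
      rw [ENNReal.rpow_neg, ENNReal.rpow_neg]
      exact ENNReal.inv_le_inv.2 (ENNReal.rpow_le_rpow
        (ENNReal.ofReal_le_ofReal (le_det_squeezeDeriv ha ha' hz.1 hz.2 h0)) hq.le)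
  refine (lintegral_mono_ae hbound).trans_lt ?_
  rw [lintegral_add_left (by fun_prop), lintegral_const_mul _ (by fun_prop),
    lintegral_const_mul _ (by fun_prop)]
  exact ENNReal.add_lt_top.2 ⟨ENNReal.mul_lt_top ENNReal.ofReal_lt_top
    (lintegral_unitBall_abs_snd_rpow_lt_top hap), ENNReal.mul_lt_top ENNReal.ofReal_lt_top
    (lintegral_unitBall_abs_snd_rpow_lt_top haq)⟩

theorem integrableOn_squeezeDeriv {a : ℝ} (ha : 0 < a) (ha' : a < 1) (i j : Fin 2) :
    IntegrableOn (fun z => squeezeDeriv a z i j) (Metric.closedBall 0 1) := by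
  have h : IntegrableOn (fun z : ℝ × ℝ => |z.2| ^ (a - 1)) (Metric.closedBall 0 1) := by
    refine ⟨(by fun_prop : Measurable fun z : ℝ × ℝ => |z.2| ^ (a - 1)).aestronglyMeasurable, ?_⟩
    rw [hasFiniteIntegral_iff_ofReal (Filter.Eventually.of_forall fun z => by positivity)]
    exact lintegral_unitBall_abs_snd_rpow_lt_top (by linarith)
  refine (h.const_mul 7).mono' (measurable_squeezeDeriv ha i j).aestronglyMeasurable ?_
  filter_upwards [ae_restrict_mem Metric.isClosed_closedBall.measurableSet,
      ae_restrict_of_ae ae_snd_ne_zero] with z hz h0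
  rw [mem_unitBall_iff] at hz
  exact abs_squeezeDeriv_le ha ha' hz.1 hz.2 h0 i j

/-! ### Integration by parts for the model map -/

/-- Fubini and the fundamental theorem of calculus on almost every horizontal line. `S` holds the
abscissae where differentiability may fail, `N` the heights of lines to be discarded. -/
theorem setIntegral_unitBall_eq_zero_fst {W w : ℝ × ℝ → ℝ}
    (hw : IntegrableOn w (Metric.closedBall 0 1)) {S N : Set ℝ} (hS : S.Countable)
    (hN : N.Countable) (hW : Continuous W) (h1 : ∀ y, W (1, y) = 0) (h2 : ∀ y, W (-1, y) = 0)
    (hd : ∀ x y, |x| ≤ 1 → x ∉ S → y ∉ N → HasDerivAt (fun s => W (s, y)) (w (x, y)) x) :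
    ∫ z in Metric.closedBall 0 1, w z = 0 := by
  rw [IntegrableOn, restrict_unitBall] at hw
  rw [restrict_unitBall, integral_prod_symm _ hw]
  refine integral_eq_zero_of_ae ?_
  filter_upwards [hw.prod_left_ae, ae_restrict_of_ae (hN.ae_notMem volume)] with y hy hyN
  simp only [Pi.zero_apply]
  have key := integral_eq_of_hasDerivAt_off_countable_of_le (fun s => W (s, y))
    (fun s => w (s, y)) (by norm_num : (-1 : ℝ) ≤ 1) hS
    (hW.comp (continuous_id.prodMk continuous_const)).continuousOn
    (fun x hx => hd x y (abs_le.2 ⟨hx.1.1.le, hx.1.2.le⟩) hx.2 hyN)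
    ((intervalIntegrable_iff_integrableOn_Icc_of_le (by norm_num)).2 hy)
  rw [intervalIntegral.integral_of_le (by norm_num), ← integral_Icc_eq_integral_Ioc] at key
  simpa [h1, h2] using key

theorem setIntegral_unitBall_eq_zero_snd {W w : ℝ × ℝ → ℝ}
    (hw : IntegrableOn w (Metric.closedBall 0 1)) {S : Set ℝ} (hS : S.Countable)
    (hW : Continuous W) (h1 : ∀ x, W (x, 1) = 0) (h2 : ∀ x, W (x, -1) = 0)
    (hd : ∀ x y, |x| ≤ 1 → y ∉ S → HasDerivAt (fun s => W (x, s)) (w (x, y)) y) :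
    ∫ z in Metric.closedBall 0 1, w z = 0 := by
  rw [IntegrableOn, restrict_unitBall] at hw
  rw [restrict_unitBall, integral_prod _ hw]
  refine integral_eq_zero_of_ae ?_
  filter_upwards [hw.prod_right_ae, ae_restrict_mem measurableSet_Icc] with x hx hx1
  simp only [Pi.zero_apply]
  have key := integral_eq_of_hasDerivAt_off_countable_of_le (fun s => W (x, s))
    (fun s => w (x, s)) (by norm_num : (-1 : ℝ) ≤ 1) hS
    (hW.comp (continuous_const.prodMk continuous_id)).continuousOn
    (fun y hy => hd x y (abs_le.2 hx1) hy.2)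
    ((intervalIntegrable_iff_integrableOn_Icc_of_le (by norm_num)).2 hx)
  rw [intervalIntegral.integral_of_le (by norm_num), ← integral_Icc_eq_integral_Ioc] at key
  simpa [h1, h2] using key

theorem continuous_coordFun (i : Fin 2) : Continuous (coordFun i) := by
  fin_cases i
  · exact continuous_fst
  · exact continuous_snd

theorem hasDerivAt_coordFun_fst (i : Fin 2) (x y : ℝ) :
    HasDerivAt (fun s => coordFun i (s, y)) ((1 : Matrix (Fin 2) (Fin 2) ℝ) i 0) x := by
  revert i
  refine Fin.forall_fin_two.2 ⟨?_, ?_⟩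
  · simpa [coordFun] using hasDerivAt_id' x
  · simpa [coordFun] using hasDerivAt_const x y

theorem hasDerivAt_coordFun_snd (i : Fin 2) (x y : ℝ) :
    HasDerivAt (fun s => coordFun i (x, s)) ((1 : Matrix (Fin 2) (Fin 2) ℝ) i 1) y := by
  revert i
  refine Fin.forall_fin_two.2 ⟨?_, ?_⟩
  · simpa [coordFun] using hasDerivAt_const y x
  · simpa [coordFun] using hasDerivAt_id' y

/-- The integrand is the `j`-th derivative of displacement times `ψ`. No boundary condition on `ψ`
is needed, because the displacement itself vanishes on the sides where the boundary terms arise. -/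
theorem setIntegral_unitBall_squeeze {a : ℝ} (ha : 0 < a) (ha' : a < 1) (i j : Fin 2)
    {ψ : ℝ × ℝ → ℝ} (hψ : ContDiff ℝ 1 ψ) :
    ∫ z in Metric.closedBall 0 1,
      ((coordFun i (squeeze a z) - coordFun i z) * fderiv ℝ ψ z (basisVec j)
        + (squeezeDeriv a z i j - (1 : Matrix (Fin 2) (Fin 2) ℝ) i j) * ψ z) = 0 := by
  have hu : Continuous fun z => coordFun i (squeeze a z) - coordFun i z :=
    ((continuous_coordFun i).comp (continuous_squeeze ha)).sub (continuous_coordFun i)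
  have hdψ : Continuous fun z => fderiv ℝ ψ z (basisVec j) :=
    (hψ.continuous_fderiv one_ne_zero).clm_apply continuous_const
  have hK : IsCompact (Metric.closedBall (0 : ℝ × ℝ) 1) := isCompact_closedBall 0 1
  have hint : IntegrableOn (fun z => (coordFun i (squeeze a z) - coordFun i z)
      * fderiv ℝ ψ z (basisVec j)
      + (squeezeDeriv a z i j - (1 : Matrix (Fin 2) (Fin 2) ℝ) i j) * ψ z)
      (Metric.closedBall 0 1) := by
    refine ((hu.mul hdψ).continuousOn.integrableOn_compact hK).add ?_
    exact IntegrableOn.mul_continuousOn ((integrableOn_squeezeDeriv ha ha' i j).sub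
      (integrableOn_const hK.measure_lt_top.ne)) hψ.continuous.continuousOn hK
  have hψd : ∀ z, HasFDerivAt ψ (fderiv ℝ ψ z) z := fun z =>
    (hψ.differentiable one_ne_zero z).hasFDerivAt
  have hW : Continuous fun z => (coordFun i (squeeze a z) - coordFun i z) * ψ z :=
    hu.mul hψ.continuous
  fin_cases j
  · refine setIntegral_unitBall_eq_zero_fst hint (S := {1 / 2, -(1 / 2)}) (N := {0})
      ((Set.finite_singleton _).insert _).countable (Set.countable_singleton _) hW
      (fun y => ?_) (fun y => ?_) ?_
    · simp [squeeze_of_abs_fst_eq_one]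
    · simp [squeeze_of_abs_fst_eq_one]
    · intro x y hx hS hN
      simp only [Set.mem_insert_iff, Set.mem_singleton_iff, not_or] at hS hN
      have h1 := (hasDerivAt_squeeze_fst ha hx hN hS.1 hS.2 i).fun_sub
        (hasDerivAt_coordFun_fst i x y)
      have h2 := (hψd (x, y)).comp_hasDerivAt x
        ((hasDerivAt_id' x).prodMk (hasDerivAt_const x y))
      refine (h1.fun_mul h2).congr_deriv ?_
      simp [basisVec, add_comm]
      exact Or.inl rfl
  · refine setIntegral_unitBall_eq_zero_snd hint (S := {0}) (Set.countable_singleton _) hW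
      (fun y => ?_) (fun y => ?_) ?_
    · simp [squeeze_of_abs_snd_eq_one ha]
    · simp [squeeze_of_abs_snd_eq_one ha]
    · intro x y hx hS
      have h1 := (hasDerivAt_squeeze_snd ha hx hS i).fun_sub
        (hasDerivAt_coordFun_snd i x y)
      have h2 := (hψd (x, y)).comp_hasDerivAt y
        ((hasDerivAt_const y x).prodMk (hasDerivAt_id' y))
      refine (h1.fun_mul h2).congr_deriv ?_
      simp [basisVec, add_comm]
      exact Or.inl rfl

/-! ### Homotheties, and gluing along a packing -/

/-- The homothety of ratio `r` carrying the unit ball to the ball of radius `r` about `c`. -/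
def scaleMap (c : ℝ × ℝ) (r : ℝ) (z : ℝ × ℝ) : ℝ × ℝ := c + r • z

theorem continuous_scaleMap (c : ℝ × ℝ) (r : ℝ) : Continuous (scaleMap c r) := by
  unfold scaleMap; fun_prop

theorem scaleMap_injective (c : ℝ × ℝ) {r : ℝ} (hr : 0 < r) : Function.Injective (scaleMap c r) :=
  fun _ _ h => smul_right_injective _ hr.ne' (add_left_cancel h)

theorem inv_smul_scaleMap_sub (c : ℝ × ℝ) {r : ℝ} (hr : 0 < r) (z : ℝ × ℝ) :
    r⁻¹ • (scaleMap c r z - c) = z := by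
  simp [scaleMap, smul_smul, inv_mul_cancel₀ hr.ne']

theorem scaleMap_inv_smul_sub (c : ℝ × ℝ) {r : ℝ} (hr : 0 < r) (x : ℝ × ℝ) :
    scaleMap c r (r⁻¹ • (x - c)) = x := by
  simp [scaleMap, smul_smul, mul_inv_cancel₀ hr.ne']

theorem scaleMap_mem_closedBall_iff (c : ℝ × ℝ) {r : ℝ} (hr : 0 < r) {z : ℝ × ℝ} :
    scaleMap c r z ∈ Metric.closedBall c r ↔ z ∈ Metric.closedBall 0 1 := by
  simp only [scaleMap, mem_closedBall_iff_norm, add_sub_cancel_left, sub_zero, norm_smul,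
    Real.norm_eq_abs, abs_of_pos hr]
  exact mul_le_iff_le_one_right hr

theorem measurableEmbedding_scaleMap (c : ℝ × ℝ) {r : ℝ} (hr : 0 < r) :
    MeasurableEmbedding (scaleMap c r) :=
  (continuous_scaleMap c r).measurableEmbedding (scaleMap_injective c hr)

theorem restrict_closedBall_eq_map (c : ℝ × ℝ) {r : ℝ} (hr : 0 < r) :
    volume.restrict (Metric.closedBall c r) = ENNReal.ofReal (r ^ 2) •
      (volume.restrict (Metric.closedBall (0 : ℝ × ℝ) 1)).map (scaleMap c r) := by
  have hpre : Metric.closedBall (0 : ℝ × ℝ) 1 = scaleMap c r ⁻¹' Metric.closedBall c r := by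
    ext z; exact (scaleMap_mem_closedBall_iff c hr).symm
  have hmap : (volume : Measure (ℝ × ℝ)).map (scaleMap c r) = ENNReal.ofReal (r ^ 2)⁻¹ • volume := by
    have h : scaleMap c r = (fun x => c + x) ∘ fun z => r • z := rfl
    rw [h, ← Measure.map_map (by fun_prop) (by fun_prop), Measure.map_addHaar_smul _ hr.ne',
      Measure.map_smul, map_add_left_eq_self]
    simp [abs_of_pos hr]
  rw [hpre, ← Measure.restrict_map (continuous_scaleMap c r).measurable
    Metric.isClosed_closedBall.measurableSet, hmap, Measure.restrict_smul, smul_smul,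
    ← ENNReal.ofReal_mul (by positivity), mul_inv_cancel₀ (by positivity)]
  simp

/-- A countable family of pairwise disjoint closed balls of positive radii. -/
structure IsBallPacking (t : Set (ℝ × ℝ)) (r : ℝ × ℝ → ℝ) : Prop where
  countable : t.Countable
  pos : ∀ c ∈ t, 0 < r c
  disjoint : t.PairwiseDisjoint fun c => Metric.closedBall c (r c)

open Classical in
/-- The function equal to `f c` on the ball about `c` for every `c ∈ t`, and to `g` elsewhere. -/
noncomputable def glue {β : Type*} (t : Set (ℝ × ℝ)) (r : ℝ × ℝ → ℝ) (f : ℝ × ℝ → ℝ × ℝ → β)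
    (g : ℝ × ℝ → β) (x : ℝ × ℝ) : β :=
  if h : ∃ c ∈ t, x ∈ Metric.closedBall c (r c) then f h.choose x else g x

theorem glue_of_mem {β : Type*} {t : Set (ℝ × ℝ)} {r : ℝ × ℝ → ℝ} (ht : IsBallPacking t r)
    (f : ℝ × ℝ → ℝ × ℝ → β) (g : ℝ × ℝ → β) {c x : ℝ × ℝ} (hc : c ∈ t)
    (hx : x ∈ Metric.closedBall c (r c)) : glue t r f g x = f c x := by
  have h : ∃ c ∈ t, x ∈ Metric.closedBall c (r c) := ⟨c, hc, hx⟩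
  rw [glue, dif_pos h, ht.disjoint.elim h.choose_spec.1 hc
    (Set.not_disjoint_iff.2 ⟨x, h.choose_spec.2, hx⟩)]

theorem glue_of_notMem {β : Type*} {t : Set (ℝ × ℝ)} {r : ℝ × ℝ → ℝ}
    (f : ℝ × ℝ → ℝ × ℝ → β) (g : ℝ × ℝ → β) {x : ℝ × ℝ}
    (hx : ∀ c ∈ t, x ∉ Metric.closedBall c (r c)) : glue t r f g x = g x :=
  dif_neg fun ⟨c, hc, h⟩ => hx c hc h

/-- The map which is a rescaled copy of `squeeze a` on each ball of the packing and the identity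
elsewhere. -/
noncomputable def packedSqueeze (a : ℝ) (t : Set (ℝ × ℝ)) (r : ℝ × ℝ → ℝ) : ℝ × ℝ → ℝ × ℝ :=
  glue t r (fun c x => scaleMap c (r c) (squeeze a ((r c)⁻¹ • (x - c)))) id

/-- The weak differential of `packedSqueeze a t r`. -/
noncomputable def packedSqueezeDeriv (a : ℝ) (t : Set (ℝ × ℝ)) (r : ℝ × ℝ → ℝ) :
    ℝ × ℝ → Matrix (Fin 2) (Fin 2) ℝ :=
  glue t r (fun c x => squeezeDeriv a ((r c)⁻¹ • (x - c))) fun _ => 1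

section Packing

variable {a : ℝ} {t : Set (ℝ × ℝ)} {r : ℝ × ℝ → ℝ}

theorem packedSqueeze_scaleMap (ht : IsBallPacking t r) {c z : ℝ × ℝ} (hc : c ∈ t)
    (hz : z ∈ Metric.closedBall 0 1) :
    packedSqueeze a t r (scaleMap c (r c) z) = scaleMap c (r c) (squeeze a z) := by
  rw [packedSqueeze, glue_of_mem ht _ _ hc ((scaleMap_mem_closedBall_iff c (ht.pos c hc)).2 hz),
    inv_smul_scaleMap_sub c (ht.pos c hc)]

theorem packedSqueezeDeriv_scaleMap (ht : IsBallPacking t r) {c z : ℝ × ℝ} (hc : c ∈ t)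
    (hz : z ∈ Metric.closedBall 0 1) :
    packedSqueezeDeriv a t r (scaleMap c (r c) z) = squeezeDeriv a z := by
  rw [packedSqueezeDeriv,
    glue_of_mem ht _ _ hc ((scaleMap_mem_closedBall_iff c (ht.pos c hc)).2 hz),
    inv_smul_scaleMap_sub c (ht.pos c hc)]

theorem packedSqueeze_of_notMem {x : ℝ × ℝ} (hx : ∀ c ∈ t, x ∉ Metric.closedBall c (r c)) :
    packedSqueeze a t r x = x := glue_of_notMem _ _ hx

theorem packedSqueezeDeriv_of_notMem {x : ℝ × ℝ} (hx : ∀ c ∈ t, x ∉ Metric.closedBall c (r c)) :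
    packedSqueezeDeriv a t r x = 1 := glue_of_notMem _ _ hx

theorem exists_scaleMap_eq (c : ℝ × ℝ) {ρ : ℝ} (hρ : 0 < ρ) {x : ℝ × ℝ}
    (hx : x ∈ Metric.closedBall c ρ) : ∃ z ∈ Metric.closedBall 0 1, scaleMap c ρ z = x :=
  ⟨ρ⁻¹ • (x - c), (scaleMap_mem_closedBall_iff c hρ).1 (by rwa [scaleMap_inv_smul_sub c hρ]),
    scaleMap_inv_smul_sub c hρ x⟩

theorem packedSqueeze_mem_closedBall (ha : 0 < a) (ht : IsBallPacking t r) {c x : ℝ × ℝ}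
    (hc : c ∈ t) (hx : x ∈ Metric.closedBall c (r c)) :
    packedSqueeze a t r x ∈ Metric.closedBall c (r c) := by
  obtain ⟨z, hz, rfl⟩ := exists_scaleMap_eq c (ht.pos c hc) hx
  rw [packedSqueeze_scaleMap ht hc hz]
  exact (scaleMap_mem_closedBall_iff c (ht.pos c hc)).2 (squeeze_mapsTo ha hz)

/-- Every ball of the packing is mapped into itself and all other points are fixed, so nothing can
enter a ball from outside. -/
theorem mem_closedBall_of_packedSqueeze_mem (ha : 0 < a) (ht : IsBallPacking t r) {c x : ℝ × ℝ}
    (hc : c ∈ t) (hx : packedSqueeze a t r x ∈ Metric.closedBall c (r c)) :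
    x ∈ Metric.closedBall c (r c) := by
  by_cases h : ∃ c' ∈ t, x ∈ Metric.closedBall c' (r c')
  · obtain ⟨c', hc', hx'⟩ := h
    have := packedSqueeze_mem_closedBall ha ht hc' hx'
    rwa [ht.disjoint.elim hc hc' (Set.not_disjoint_iff.2 ⟨_, hx, this⟩)]
  · push Not at h
    rwa [packedSqueeze_of_notMem h] at hx

theorem packedSqueeze_eq_imp (ha : 0 < a) (ht : IsBallPacking t r) {x x' : ℝ × ℝ}
    (h : packedSqueeze a t r x = packedSqueeze a t r x') :
    x = x' ∨ ∃ c ∈ t, x ∈ scaleMap c (r c) '' collapsedSegment ∧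
      x' ∈ scaleMap c (r c) '' collapsedSegment := by
  by_cases hx : ∃ c ∈ t, packedSqueeze a t r x ∈ Metric.closedBall c (r c)
  · obtain ⟨c, hc, hx⟩ := hx
    obtain ⟨z, hz, rfl⟩ := exists_scaleMap_eq c (ht.pos c hc)
      (mem_closedBall_of_packedSqueeze_mem ha ht hc hx)
    obtain ⟨w, hw, rfl⟩ := exists_scaleMap_eq c (ht.pos c hc)
      (mem_closedBall_of_packedSqueeze_mem ha ht hc (h ▸ hx))
    rw [packedSqueeze_scaleMap ht hc hz, packedSqueeze_scaleMap ht hc hw] at h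
    rcases eq_or_mem_collapsedSegment ha hz hw (scaleMap_injective c (ht.pos c hc) h) with
      h | ⟨h1, h2⟩
    · exact Or.inl (by rw [h])
    · exact Or.inr ⟨c, hc, Set.mem_image_of_mem _ h1, Set.mem_image_of_mem _ h2⟩
  · push Not at hx
    have h1 : ∀ y, packedSqueeze a t r y = packedSqueeze a t r x → packedSqueeze a t r y = y :=
      fun y hy => packedSqueeze_of_notMem fun c hc hyc =>
        hx c hc (hy ▸ packedSqueeze_mem_closedBall ha ht hc hyc)
    exact Or.inl ((h1 x rfl).symm.trans (h.trans (h1 x' h.symm)))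

theorem packedSqueeze_of_mem_segment (ht : IsBallPacking t r) {c x : ℝ × ℝ} (hc : c ∈ t)
    (hx : x ∈ scaleMap c (r c) '' collapsedSegment) : packedSqueeze a t r x = c := by
  obtain ⟨z, hz, rfl⟩ := hx
  rw [packedSqueeze_scaleMap ht hc (collapsedSegment_subset hz),
    squeeze_of_mem_collapsedSegment hz]
  simp [scaleMap]

theorem segment_subset_closedBall (c : ℝ × ℝ) {ρ : ℝ} (hρ : 0 < ρ) :
    scaleMap c ρ '' collapsedSegment ⊆ Metric.closedBall c ρ := by
  rintro _ ⟨z, hz, rfl⟩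
  exact (scaleMap_mem_closedBall_iff c hρ).2 (collapsedSegment_subset hz)

theorem image_packedSqueeze (ha : 0 < a) (ht : IsBallPacking t r) {A : Set (ℝ × ℝ)}
    (hA : ∀ c ∈ t, Metric.closedBall c (r c) ⊆ A) : packedSqueeze a t r '' A = A := by
  apply Set.Subset.antisymm
  · rintro _ ⟨x, hx, rfl⟩
    by_cases h : ∃ c ∈ t, x ∈ Metric.closedBall c (r c)
    · obtain ⟨c, hc, hxc⟩ := h
      exact hA c hc (packedSqueeze_mem_closedBall ha ht hc hxc)
    · push Not at h
      rwa [packedSqueeze_of_notMem h]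
  · intro x hx
    by_cases h : ∃ c ∈ t, x ∈ Metric.closedBall c (r c)
    · obtain ⟨c, hc, hxc⟩ := h
      obtain ⟨z, hz, rfl⟩ := exists_scaleMap_eq c (ht.pos c hc) hxc
      obtain ⟨w, hw, rfl⟩ := squeeze_surjOn ha hz
      exact ⟨scaleMap c (r c) w, hA c hc ((scaleMap_mem_closedBall_iff c (ht.pos c hc)).2 hw),
        packedSqueeze_scaleMap ht hc hw⟩
    · push Not at h
      exact ⟨x, hx, packedSqueeze_of_notMem h⟩

/-! ### Continuity of the glued map -/

/-- The nearest point retraction of the plane onto the unit ball of the supremum norm. -/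
def clampBall (z : ℝ × ℝ) : ℝ × ℝ := (max (-1) (min 1 z.1), max (-1) (min 1 z.2))

theorem clampBall_mem (z : ℝ × ℝ) : clampBall z ∈ Metric.closedBall (0 : ℝ × ℝ) 1 := by
  refine mem_unitBall_iff.2 ⟨abs_le.2 ⟨le_max_left _ _, ?_⟩, abs_le.2 ⟨le_max_left _ _, ?_⟩⟩ <;>
    exact max_le (by norm_num) (min_le_left _ _)

theorem clampBall_of_mem {z : ℝ × ℝ} (hz : z ∈ Metric.closedBall (0 : ℝ × ℝ) 1) :
    clampBall z = z := by
  rw [mem_unitBall_iff, abs_le, abs_le] at hz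
  ext
  · simp [clampBall, hz.1.1, hz.1.2]
  · simp [clampBall, hz.2.1, hz.2.2]

theorem abs_max_min_eq_one {s : ℝ} (hs : 1 < |s|) : |max (-1) (min 1 s)| = 1 := by
  rcases lt_abs.1 hs with h | h
  · simp [min_eq_left h.le]
  · rw [min_eq_right (by linarith), max_eq_left (by linarith)]; simp

/-- Clamping sends outside points to the boundary, where the model map is the identity. The
displacement thus extends continuously by zero. -/
theorem squeeze_clampBall_of_notMem (ha : 0 < a) {z : ℝ × ℝ}
    (hz : z ∉ Metric.closedBall (0 : ℝ × ℝ) 1) : squeeze a (clampBall z) = clampBall z := by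
  rw [mem_unitBall_iff, not_and_or, not_le, not_le] at hz
  rcases hz with h | h
  · exact squeeze_of_abs_fst_eq_one (abs_max_min_eq_one h)
  · exact squeeze_of_abs_snd_eq_one ha (abs_max_min_eq_one h)

/-- The displacement of the rescaled copy of `squeeze a` on the ball of radius `ρ` about `c`. -/
noncomputable def displacement (a : ℝ) (c : ℝ × ℝ) (ρ : ℝ) (x : ℝ × ℝ) : ℝ × ℝ :=
  ρ • (squeeze a (clampBall (ρ⁻¹ • (x - c))) - clampBall (ρ⁻¹ • (x - c)))

theorem continuous_displacement (ha : 0 < a) (c : ℝ × ℝ) (ρ : ℝ) :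
    Continuous (displacement a c ρ) := by
  have h1 : Continuous fun x : ℝ × ℝ => clampBall (ρ⁻¹ • (x - c)) := by
    unfold clampBall; fun_prop
  exact (((continuous_squeeze ha).comp h1).sub h1).const_smul ρ

theorem displacement_of_notMem (ha : 0 < a) {c x : ℝ × ℝ} {ρ : ℝ} (hρ : 0 < ρ)
    (hx : x ∉ Metric.closedBall c ρ) : displacement a c ρ x = 0 := by
  have h : ρ⁻¹ • (x - c) ∉ Metric.closedBall (0 : ℝ × ℝ) 1 := by
    rwa [← scaleMap_mem_closedBall_iff c hρ, scaleMap_inv_smul_sub c hρ]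
  rw [displacement, squeeze_clampBall_of_notMem ha h, sub_self, smul_zero]

theorem norm_displacement_le (ha : 0 < a) (c x : ℝ × ℝ) {ρ : ℝ} (hρ : 0 < ρ) :
    ‖displacement a c ρ x‖ ≤ ρ * 2 := by
  have h1 := clampBall_mem (ρ⁻¹ • (x - c))
  have h2 := squeeze_mapsTo ha h1
  rw [mem_closedBall_zero_iff] at h1 h2
  rw [displacement, norm_smul, Real.norm_eq_abs, abs_of_pos hρ]
  gcongr
  exact (norm_sub_le _ _).trans (by linarith)

theorem packedSqueeze_eq_add_displacement (ht : IsBallPacking t r) {c x : ℝ × ℝ} (hc : c ∈ t)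
    (hx : x ∈ Metric.closedBall c (r c)) :
    packedSqueeze a t r x = x + displacement a c (r c) x := by
  obtain ⟨z, hz, rfl⟩ := exists_scaleMap_eq c (ht.pos c hc) hx
  rw [packedSqueeze_scaleMap ht hc hz, displacement, inv_smul_scaleMap_sub c (ht.pos c hc),
    clampBall_of_mem hz, scaleMap, scaleMap, smul_sub]
  abel

/-- Disjoint sets whose volumes are bounded below fit only finitely often into finite volume. -/
theorem finite_large_balls (ht : IsBallPacking t r) {A : Set (ℝ × ℝ)} (hAv : volume A ≠ ⊤)
    (hA : ∀ c ∈ t, Metric.closedBall c (r c) ⊆ A) {ε : ℝ} (hε : 0 < ε) :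
    {c ∈ t | ε ≤ r c}.Finite := by
  have hpos : 0 < volume (Metric.closedBall (0 : ℝ × ℝ) ε) :=
    Metric.measure_closedBall_pos volume 0 hε
  have := Measure.finite_const_le_meas_of_disjoint_iUnion volume hpos
    (As := fun c : t => Metric.closedBall (c : ℝ × ℝ) (r c))
    (fun c => Metric.isClosed_closedBall.measurableSet)
    (fun c c' hne => ht.disjoint c.2 c'.2 fun h => hne (Subtype.ext h))
    (measure_ne_top_of_subset (Set.iUnion_subset fun c => hA c c.2) hAv)
  refine (this.image Subtype.val).subset ?_
  rintro c ⟨hc, hcε⟩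
  refine ⟨⟨c, hc⟩, ?_, rfl⟩
  simp only [Set.mem_ofPred_eq]
  rw [← Measure.addHaar_closedBall_center volume c]
  exact measure_mono (Metric.closedBall_subset_closedBall hcε)

/-- The map is a uniform limit of the identity plus finitely many displacements: a ball of radius
below `ε / 2` moves points by less than `ε`, and only finitely many balls are larger. -/
theorem continuous_packedSqueeze (ha : 0 < a) (ht : IsBallPacking t r) {A : Set (ℝ × ℝ)}
    (hAv : volume A ≠ ⊤) (hA : ∀ c ∈ t, Metric.closedBall c (r c) ⊆ A) :
    Continuous (packedSqueeze a t r) := by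
  refine continuous_of_uniform_approx_of_continuous fun u hu => ?_
  obtain ⟨ε, hε, hu⟩ := Metric.mem_uniformity_dist.1 hu
  have hfin := finite_large_balls ht hAv hA (half_pos hε)
  refine ⟨fun x => x + ∑ c ∈ hfin.toFinset, displacement a c (r c) x,
    continuous_id.add (continuous_finsetSum _ fun c _ => continuous_displacement ha c _),
    fun x => hu ?_⟩
  beta_reduce
  by_cases h : ∃ c ∈ t, x ∈ Metric.closedBall c (r c)
  · obtain ⟨c, hc, hx⟩ := h
    have hother : ∀ c' ∈ hfin.toFinset, c' ≠ c → displacement a c' (r c') x = 0 := by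
      intro c' hc' hne
      rw [Set.Finite.mem_toFinset] at hc'
      refine displacement_of_notMem ha (ht.pos c' hc'.1) fun hx' => hne ?_
      exact ht.disjoint.elim hc'.1 hc (Set.not_disjoint_iff.2 ⟨x, hx', hx⟩)
    rw [packedSqueeze_eq_add_displacement ht hc hx]
    by_cases hcε : ε / 2 ≤ r c
    · rw [Finset.sum_eq_single_of_mem c (hfin.mem_toFinset.2 ⟨hc, hcε⟩) hother, dist_self]
      exact hε
    · rw [Finset.sum_eq_zero fun c' hc' => hother c' hc' ?_, add_zero, dist_self_add_left]
      · exact (norm_displacement_le ha c x (ht.pos c hc)).trans_lt (by linarith)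
      · rintro rfl
        exact hcε (hfin.mem_toFinset.1 hc').2
  · push Not at h
    rw [packedSqueeze_of_notMem h, Finset.sum_eq_zero fun c hc =>
      displacement_of_notMem ha (ht.pos c (hfin.mem_toFinset.1 hc).1)
        (h c (hfin.mem_toFinset.1 hc).1), add_zero, dist_self]
    exact hε

end Packing

/-! ### Monotonicity of the glued map -/

/-- A cover of the preimage by two closed sets has compact image pieces covering `C`, which
therefore share a value. The fibre over it meets both sets and, being connected, contains a common
point. -/
theorem isPreconnected_preimage_of_fibers {A C : Set (ℝ × ℝ)} {h : ℝ × ℝ → ℝ × ℝ}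
    (hh : Continuous h) (hA : IsCompact A) (hC : IsCompact C) (hC' : IsPreconnected C)
    (hCA : C ⊆ h '' A) (hfib : ∀ y, IsPreconnected (A ∩ h ⁻¹' {y})) :
    IsPreconnected (A ∩ h ⁻¹' C) := by
  have hS : IsCompact (A ∩ h ⁻¹' C) := hA.inter_right (hC.isClosed.preimage hh)
  rw [isPreconnected_closed_iff] at hC' ⊢
  rintro t t' ht ht' hcov ⟨x, hx, hxt⟩ ⟨x', hx', hxt'⟩
  obtain ⟨y, hyC, ⟨z, hz, rfl⟩, ⟨z', hz', hzz'⟩⟩ :=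
    hC' (h '' ((A ∩ h ⁻¹' C) ∩ t)) (h '' ((A ∩ h ⁻¹' C) ∩ t'))
      ((hS.inter_right ht).image hh).isClosed ((hS.inter_right ht').image hh).isClosed
      (fun y hy => by
        obtain ⟨z, hz, rfl⟩ := hCA hy
        rcases hcov ⟨hz, hy⟩ with h1 | h1
        · exact Or.inl ⟨z, ⟨⟨hz, hy⟩, h1⟩, rfl⟩
        · exact Or.inr ⟨z, ⟨⟨hz, hy⟩, h1⟩, rfl⟩)
      ⟨h x, hx.2, x, ⟨hx, hxt⟩, rfl⟩ ⟨h x', hx'.2, x', ⟨hx', hxt'⟩, rfl⟩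
  have hsub : A ∩ h ⁻¹' {h z} ⊆ A ∩ h ⁻¹' C := by
    rintro w ⟨hw, hwz⟩
    refine ⟨hw, ?_⟩
    rw [Set.mem_preimage, Set.mem_singleton_iff] at hwz
    rw [Set.mem_preimage, hwz]
    exact hyC
  obtain ⟨w, hw, hw'⟩ := isPreconnected_closed_iff.1 (hfib (h z)) t t' ht ht' (hsub.trans hcov)
    ⟨z, ⟨hz.1.1, rfl⟩, hz.2⟩ ⟨z', ⟨hz'.1.1, hzz'⟩, hz'.2⟩
  exact ⟨w, hsub hw, hw'⟩

theorem isMonotoneOnto_packedSqueeze {a : ℝ} {t : Set (ℝ × ℝ)} {r : ℝ × ℝ → ℝ} (ha : 0 < a)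
    (ht : IsBallPacking t r) {A : Set (ℝ × ℝ)} (hAc : IsCompact A)
    (hA : ∀ c ∈ t, Metric.closedBall c (r c) ⊆ A) :
    IsMonotoneOnto A A (packedSqueeze a t r) := by
  have hcont := continuous_packedSqueeze ha ht hAc.measure_lt_top.ne hA
  have himg := image_packedSqueeze ha ht hA
  refine ⟨hcont.continuousOn, himg, fun C hCA hC =>
    ⟨hAc.inter_right (hC.1.isClosed.preimage hcont), ?_, ?_⟩⟩
  · obtain ⟨y, hy⟩ := hC.2.nonempty
    obtain ⟨x, hx, rfl⟩ := himg.symm ▸ hCA hy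
    exact ⟨x, hx, hy⟩
  · refine isPreconnected_preimage_of_fibers hcont hAc hC.1 hC.2.isPreconnected
      (hCA.trans himg.superset) fun y => isPreconnected_of_forall_pair fun x hx x' hx' => ?_
    rcases packedSqueeze_eq_imp ha ht (hx.2.trans hx'.2.symm) with h | ⟨c, hc, h1, h2⟩
    · subst h
      exact ⟨{x}, Set.singleton_subset_iff.2 hx, rfl, rfl, isPreconnected_singleton⟩
    · refine ⟨_, fun w hw => ⟨hA c hc (segment_subset_closedBall c (ht.pos c hc) hw), ?_⟩, h1, h2,
        (isPreconnected_Icc.prod isPreconnected_singleton).image _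
          (continuous_scaleMap c (r c)).continuousOn⟩
      have hxy : packedSqueeze a t r x = y := hx.2
      rw [packedSqueeze_of_mem_segment ht hc h1] at hxy
      exact (packedSqueeze_of_mem_segment ht hc hw).trans hxy

/-! ### Energy and weak differential of the glued map -/

section Packing

variable {a : ℝ} {t : Set (ℝ × ℝ)} {r : ℝ × ℝ → ℝ}

/-- The union of the balls of a packing. -/
def packedUnion (t : Set (ℝ × ℝ)) (r : ℝ × ℝ → ℝ) : Set (ℝ × ℝ) :=
  ⋃ c : t, Metric.closedBall (c : ℝ × ℝ) (r c)

theorem notMem_closedBall_of_notMem_packedUnion {x : ℝ × ℝ} (hx : x ∉ packedUnion t r) :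
    ∀ c ∈ t, x ∉ Metric.closedBall c (r c) := fun c hc h =>
  hx (Set.mem_iUnion.2 ⟨⟨c, hc⟩, h⟩)

theorem IsBallPacking.pairwise_disjoint (ht : IsBallPacking t r) :
    Pairwise (Function.onFun Disjoint fun c : t => Metric.closedBall (c : ℝ × ℝ) (r c)) :=
  fun c c' hne => ht.disjoint c.2 c'.2 fun h => hne (Subtype.ext h)

theorem IsBallPacking.measurableSet_packedUnion (ht : IsBallPacking t r) :
    MeasurableSet (packedUnion t r) := by
  have := ht.countable.to_subtype
  exact MeasurableSet.iUnion fun c => Metric.isClosed_closedBall.measurableSet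

theorem packedUnion_subset {A : Set (ℝ × ℝ)} (hA : ∀ c ∈ t, Metric.closedBall c (r c) ⊆ A) :
    packedUnion t r ⊆ A := Set.iUnion_subset fun c => hA c c.2

theorem lintegral_closedBall (c : ℝ × ℝ) {ρ : ℝ} (hρ : 0 < ρ) (f : ℝ × ℝ → ℝ≥0∞) :
    ∫⁻ x in Metric.closedBall c ρ, f x =
      ENNReal.ofReal (ρ ^ 2) * ∫⁻ z in Metric.closedBall 0 1, f (scaleMap c ρ z) := by
  rw [restrict_closedBall_eq_map c hρ, lintegral_smul_measure,
    (measurableEmbedding_scaleMap c hρ).lintegral_map, smul_eq_mul]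

theorem setIntegral_closedBall (c : ℝ × ℝ) {ρ : ℝ} (hρ : 0 < ρ) (f : ℝ × ℝ → ℝ) :
    ∫ x in Metric.closedBall c ρ, f x =
      ρ ^ 2 * ∫ z in Metric.closedBall 0 1, f (scaleMap c ρ z) := by
  rw [restrict_closedBall_eq_map c hρ, integral_smul_measure,
    (measurableEmbedding_scaleMap c hρ).integral_map, smul_eq_mul,
    ENNReal.toReal_ofReal (by positivity)]

theorem tsum_sq_radius_ne_top (ht : IsBallPacking t r) {A : Set (ℝ × ℝ)} (hAv : volume A ≠ ⊤)
    (hA : ∀ c ∈ t, Metric.closedBall c (r c) ⊆ A) :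
    ∑' c : t, ENNReal.ofReal (r c ^ 2) ≠ ⊤ := by
  have := ht.countable.to_subtype
  have h1 : volume (packedUnion t r) =
      (∑' c : t, ENNReal.ofReal (r c ^ 2)) * volume (Metric.closedBall (0 : ℝ × ℝ) 1) := by
    rw [packedUnion, measure_iUnion ht.pairwise_disjoint
      (fun c => Metric.isClosed_closedBall.measurableSet), ← ENNReal.tsum_mul_right]
    refine tsum_congr fun c => ?_
    have := lintegral_closedBall c (ht.pos c c.2) fun _ => 1
    simpa using this
  have h2 : volume (packedUnion t r) ≠ ⊤ :=
    measure_ne_top_of_subset (packedUnion_subset hA) hAv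
  intro h
  rw [h1, h, ENNReal.top_mul (Metric.measure_closedBall_pos volume 0 one_pos).ne'] at h2
  exact h2 rfl

theorem neohookeanEnergy_packedSqueezeDeriv_lt_top {p q : ℝ} (ht : IsBallPacking t r)
    {X : Set (ℝ × ℝ)} (hXv : volume X ≠ ⊤)
    (hX : ∀ c ∈ t, Metric.closedBall c (r c) ⊆ X)
    (hE : neohookeanEnergy p q (Metric.closedBall 0 1) (squeezeDeriv a) < ⊤) :
    neohookeanEnergy p q X (packedSqueezeDeriv a t r) < ⊤ := by
  have := ht.countable.to_subtype
  have hU : neohookeanEnergy p q (packedUnion t r) (packedSqueezeDeriv a t r) < ⊤ := by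
    rw [neohookeanEnergy, packedUnion, lintegral_iUnion
      (fun c => Metric.isClosed_closedBall.measurableSet) ht.pairwise_disjoint]
    have : ∀ c : t, ∫⁻ x in Metric.closedBall (c : ℝ × ℝ) (r c),
        (ENNReal.ofReal (hilbertSchmidt (packedSqueezeDeriv a t r x) ^ p)
          + ENNReal.ofReal (packedSqueezeDeriv a t r x).det ^ (-q)) =
        ENNReal.ofReal (r c ^ 2) *
          neohookeanEnergy p q (Metric.closedBall 0 1) (squeezeDeriv a) := by
      intro c
      rw [lintegral_closedBall c (ht.pos c c.2), neohookeanEnergy]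
      congr 1
      refine setLIntegral_congr_fun Metric.isClosed_closedBall.measurableSet fun z hz => ?_
      rw [packedSqueezeDeriv_scaleMap ht c.2 hz]
    rw [tsum_congr this, ENNReal.tsum_mul_right]
    exact ENNReal.mul_lt_top (tsum_sq_radius_ne_top ht hXv hX).lt_top hE
  have hV : neohookeanEnergy p q (X \ packedUnion t r) (packedSqueezeDeriv a t r) < ⊤ := by
    have hle : neohookeanEnergy p q (X \ packedUnion t r) (packedSqueezeDeriv a t r) ≤
        ∫⁻ _ in X \ packedUnion t r,
          (ENNReal.ofReal (hilbertSchmidt 1 ^ p) + ENNReal.ofReal (1 : ℝ) ^ (-q)) := by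
      refine lintegral_mono_ae ?_
      have hc : ∀ᵐ x ∂volume.restrict (X \ packedUnion t r), x ∉ packedUnion t r := by
        have h1 : volume.restrict (X \ packedUnion t r) ≤
            volume.restrict (packedUnion t r)ᶜ :=
          Measure.restrict_mono (fun x hx => hx.2) le_rfl
        exact ae_mono h1 (ae_restrict_mem ht.measurableSet_packedUnion.compl)
      filter_upwards [hc] with x hx
      rw [packedSqueezeDeriv_of_notMem (notMem_closedBall_of_notMem_packedUnion hx),
        Matrix.det_one]
    refine hle.trans_lt ?_
    rw [setLIntegral_const]
    refine ENNReal.mul_lt_top (by simp) ?_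
    exact (measure_ne_top_of_subset Set.sdiff_subset hXv).lt_top
  calc neohookeanEnergy p q X (packedSqueezeDeriv a t r)
      ≤ neohookeanEnergy p q (packedUnion t r ∪ (X \ packedUnion t r))
          (packedSqueezeDeriv a t r) :=
        lintegral_mono_set (by rw [Set.union_sdiff_self]; exact Set.subset_union_right)
    _ ≤ _ := lintegral_union_le _ _ _
    _ < ⊤ := ENNReal.add_lt_top.2 ⟨hU, hV⟩

theorem aestronglyMeasurable_packedSqueezeDeriv (ha : 0 < a) (ht : IsBallPacking t r)
    (i j : Fin 2) : AEStronglyMeasurable (fun x => packedSqueezeDeriv a t r x i j) volume := by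
  have := ht.countable.to_subtype
  rw [← Measure.restrict_univ (μ := volume), ← Set.union_compl_self (packedUnion t r),
    aestronglyMeasurable_union_iff, packedUnion, aestronglyMeasurable_iUnion_iff]
  refine ⟨fun c => ?_, ?_⟩
  · have hm : Measurable fun x : ℝ × ℝ => squeezeDeriv a ((r c)⁻¹ • (x - c)) i j :=
      (measurable_squeezeDeriv ha i j).comp (by fun_prop)
    refine hm.aestronglyMeasurable.congr ?_
    filter_upwards [ae_restrict_mem Metric.isClosed_closedBall.measurableSet] with x hx
    rw [packedSqueezeDeriv, glue_of_mem ht _ _ c.2 hx]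
  · refine (aestronglyMeasurable_const (b := (1 : Matrix (Fin 2) (Fin 2) ℝ) i j)).congr ?_
    filter_upwards [ae_restrict_mem ht.measurableSet_packedUnion.compl] with x hx
    rw [packedSqueezeDeriv_of_notMem (notMem_closedBall_of_notMem_packedUnion hx)]

theorem contDiff_scaleMap {n : WithTop ℕ∞} (c : ℝ × ℝ) (ρ : ℝ) :
    ContDiff ℝ n (scaleMap c ρ) := by
  unfold scaleMap; fun_prop

theorem fderiv_comp_scaleMap {φ : ℝ × ℝ → ℝ} (hφ : Differentiable ℝ φ) (c : ℝ × ℝ) (ρ : ℝ)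
    (z v : ℝ × ℝ) :
    fderiv ℝ (φ ∘ scaleMap c ρ) z v = ρ * fderiv ℝ φ (scaleMap c ρ z) v := by
  have h1 : HasFDerivAt (scaleMap c ρ) (ρ • ContinuousLinearMap.id ℝ (ℝ × ℝ)) z :=
    ((hasFDerivAt_id z).const_smul ρ).const_add c
  rw [((hφ _).hasFDerivAt.comp z h1).fderiv]
  simp

theorem coordFun_sub (i : Fin 2) (x y : ℝ × ℝ) :
    coordFun i (x - y) = coordFun i x - coordFun i y := by
  fin_cases i <;> simp [coordFun]

theorem coordFun_smul (i : Fin 2) (s : ℝ) (x : ℝ × ℝ) :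
    coordFun i (s • x) = s * coordFun i x := by
  fin_cases i <;> simp [coordFun]

theorem setIntegral_closedBall_packedSqueeze (ha : 0 < a) (ha' : a < 1) (ht : IsBallPacking t r)
    {c : ℝ × ℝ} (hc : c ∈ t) (i j : Fin 2) {φ : ℝ × ℝ → ℝ} (hφ : ContDiff ℝ 1 φ) :
    ∫ x in Metric.closedBall c (r c),
      ((coordFun i (packedSqueeze a t r x) - coordFun i x) * fderiv ℝ φ x (basisVec j)
        + (packedSqueezeDeriv a t r x i j - (1 : Matrix (Fin 2) (Fin 2) ℝ) i j) * φ x) = 0 := by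
  have hr := ht.pos c hc
  rw [setIntegral_closedBall c hr,
    ← mul_zero (r c ^ 2), ← setIntegral_unitBall_squeeze ha ha' i j
      (hφ.comp (contDiff_scaleMap c (r c)))]
  congr 1
  refine setIntegral_congr_fun Metric.isClosed_closedBall.measurableSet fun z hz => ?_
  rw [packedSqueeze_scaleMap ht hc hz, packedSqueezeDeriv_scaleMap ht hc hz,
    fderiv_comp_scaleMap (hφ.differentiable one_ne_zero), ← coordFun_sub, ← coordFun_sub]
  -- The factor `r c` of the displacement is the one the chain rule puts on the derivative of the
  -- rescaled test function.
  have : scaleMap c (r c) (squeeze a z) - scaleMap c (r c) z = r c • (squeeze a z - z) := by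
    rw [scaleMap, scaleMap, smul_sub]; abel
  rw [this, coordFun_smul, Function.comp_apply]
  ring

theorem fderiv_coordFun (i j : Fin 2) (x : ℝ × ℝ) :
    fderiv ℝ (coordFun i) x (basisVec j) = (1 : Matrix (Fin 2) (Fin 2) ℝ) i j := by
  revert i
  refine Fin.forall_fin_two.2 ⟨?_, ?_⟩
  · have : coordFun 0 = Prod.fst := rfl
    rw [this, fderiv_fst]
    revert j
    refine Fin.forall_fin_two.2 ⟨?_, ?_⟩ <;> simp [basisVec]
  · have : coordFun 1 = Prod.snd := rfl
    rw [this, fderiv_snd]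
    revert j
    refine Fin.forall_fin_two.2 ⟨?_, ?_⟩ <;> simp [basisVec]

theorem contDiff_coordFun {n : WithTop ℕ∞} (i : Fin 2) : ContDiff ℝ n (coordFun i) := by
  fin_cases i
  · exact contDiff_fst
  · exact contDiff_snd

theorem integral_coordFun_mul_fderiv (i j : Fin 2) {φ : ℝ × ℝ → ℝ} (hφ : ContDiff ℝ 1 φ)
    (hc : HasCompactSupport φ) :
    ∫ x, (coordFun i x * fderiv ℝ φ x (basisVec j) + (1 : Matrix (Fin 2) (Fin 2) ℝ) i j * φ x)
      = 0 := by
  have hdφ : Continuous fun z => fderiv ℝ φ z (basisVec j) :=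
    (hφ.continuous_fderiv one_ne_zero).clm_apply continuous_const
  have hdc : HasCompactSupport fun z => fderiv ℝ φ z (basisVec j) := hc.fderiv_apply ℝ _
  have h1 : Integrable fun x => coordFun i x * fderiv ℝ φ x (basisVec j) :=
    ((continuous_coordFun i).mul hdφ).integrable_of_hasCompactSupport hdc.mul_left
  have h2 : Integrable fun x => (1 : Matrix (Fin 2) (Fin 2) ℝ) i j * φ x :=
    (hφ.continuous.integrable_of_hasCompactSupport hc).const_mul _
  have h3 : Integrable fun x => coordFun i x * φ x :=
    ((continuous_coordFun i).mul hφ.continuous).integrable_of_hasCompactSupport hc.mul_left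
  have key := integral_mul_fderiv_eq_neg_fderiv_mul_of_integrable (μ := volume)
    (f := coordFun i) (g := φ) (v := basisVec j) (by simpa only [fderiv_coordFun] using h2) h1 h3
    (fun x _ => (contDiff_coordFun (n := 1) i).differentiable one_ne_zero x)
    (fun x _ => hφ.differentiable one_ne_zero x)
  rw [integral_add h1 h2, key]
  simp only [fderiv_coordFun]
  simp

/-- The map is split as identity plus displacement. The identity contributes ordinary integration by
parts (`h4`); the displacement part is zero off the packing and integrates to zero on each ball
(`h6`). -/
theorem hasWeakPartialDeriv_packedSqueeze (ha : 0 < a) (ha' : a < 1) (ht : IsBallPacking t r)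
    {X : Set (ℝ × ℝ)} (hX : ∀ c ∈ t, Metric.closedBall c (r c) ⊆ X) (i j : Fin 2)
    (hXm : MeasurableSet X)
    (hh : IntegrableOn (fun x => coordFun i (packedSqueeze a t r x)) X)
    (hhX : Continuous (packedSqueeze a t r))
    (hD : IntegrableOn (fun x => packedSqueezeDeriv a t r x i j) X) :
    HasWeakPartialDeriv X j (fun x => coordFun i (packedSqueeze a t r x))
      (fun x => packedSqueezeDeriv a t r x i j) := by
  refine ⟨hh.locallyIntegrableOn, hD.locallyIntegrableOn, fun φ hφ hφc hφX => ?_⟩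
  have := ht.countable.to_subtype
  have hφ1 : ContDiff ℝ 1 φ := hφ.of_le (by exact_mod_cast le_top)
  have hdφ : Continuous fun z => fderiv ℝ φ z (basisVec j) :=
    (hφ1.continuous_fderiv one_ne_zero).clm_apply continuous_const
  have hdc : HasCompactSupport fun z => fderiv ℝ φ z (basisVec j) := hφc.fderiv_apply ℝ _
  have hhc : Continuous fun x => coordFun i (packedSqueeze a t r x) :=
    (continuous_coordFun i).comp hhX
  have h1 : IntegrableOn (fun x => coordFun i (packedSqueeze a t r x)
      * fderiv ℝ φ x (basisVec j)) X :=
    ((hhc.mul hdφ).integrable_of_hasCompactSupport hdc.mul_left).integrableOn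
  have h2 : IntegrableOn (fun x => packedSqueezeDeriv a t r x i j * φ x) X := by
    obtain ⟨C, hC⟩ := hφ1.continuous.bounded_above_of_compact_support hφc
    exact hD.mul_bdd hφ1.continuous.aestronglyMeasurable (Filter.Eventually.of_forall hC)
  have h3 : Integrable fun x => coordFun i x * fderiv ℝ φ x (basisVec j)
      + (1 : Matrix (Fin 2) (Fin 2) ℝ) i j * φ x :=
    (((continuous_coordFun i).mul hdφ).integrable_of_hasCompactSupport hdc.mul_left).add
      ((hφ1.continuous.integrable_of_hasCompactSupport hφc).const_mul _)
  have h4 : ∫ x in X, (coordFun i x * fderiv ℝ φ x (basisVec j)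
      + (1 : Matrix (Fin 2) (Fin 2) ℝ) i j * φ x) = 0 := by
    rw [setIntegral_eq_integral_of_forall_compl_eq_zero, integral_coordFun_mul_fderiv i j hφ1 hφc]
    intro x hx
    have hx' : x ∉ tsupport φ := fun h => hx (hφX h)
    have hd : fderiv ℝ φ x = 0 := by
      by_contra hne
      exact hx' (support_fderiv_subset ℝ hne)
    simp [hd, image_eq_zero_of_notMem_tsupport hx']
  have h5 : IntegrableOn (fun x =>
      (coordFun i (packedSqueeze a t r x) - coordFun i x) * fderiv ℝ φ x (basisVec j)
        + (packedSqueezeDeriv a t r x i j - (1 : Matrix (Fin 2) (Fin 2) ℝ) i j) * φ x) X := by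
    refine ((h1.add h2).sub h3.integrableOn).congr (Filter.Eventually.of_forall fun x => ?_)
    simp only [Pi.add_apply, Pi.sub_apply]
    ring
  have h6 : ∫ x in X,
      ((coordFun i (packedSqueeze a t r x) - coordFun i x) * fderiv ℝ φ x (basisVec j)
        + (packedSqueezeDeriv a t r x i j - (1 : Matrix (Fin 2) (Fin 2) ℝ) i j) * φ x) = 0 := by
    rw [setIntegral_eq_of_subset_of_forall_sdiff_eq_zero hXm (packedUnion_subset hX),
      packedUnion, integral_iUnion (fun c => Metric.isClosed_closedBall.measurableSet)
      ht.pairwise_disjoint (h5.mono_set (packedUnion_subset hX))]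
    · simp only [setIntegral_closedBall_packedSqueeze ha ha' ht (Subtype.coe_prop _) i j hφ1,
        tsum_zero]
    · rintro x ⟨-, hx⟩
      have hx := notMem_closedBall_of_notMem_packedUnion hx
      rw [packedSqueeze_of_notMem hx, packedSqueezeDeriv_of_notMem hx]
      ring
  -- The zero on the right is written as `0 + 0`, to be replaced by the integrals of `h4` and `h6`.
  rw [eq_neg_iff_add_eq_zero, ← integral_add h1 h2, ← add_zero (0 : ℝ)]
  nth_rewrite 1 [← h4]
  rw [← h6, ← integral_add h3.integrableOn h5]
  refine integral_congr_ae (Filter.Eventually.of_forall fun x => ?_)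
  simp only
  ring

end Packing

/-! ### The packing in the unit square and the branch set -/

theorem isOpen_unitSquare : IsOpen unitSquare := isOpen_Ioo.prod isOpen_Ioo

theorem volume_unitSquare : volume unitSquare = 1 := by
  rw [unitSquare, Measure.volume_eq_prod, Measure.prod_prod]; simp

theorem isCompact_closure_unitSquare : IsCompact (closure unitSquare) :=
  (isCompact_Icc.prod isCompact_Icc).of_isClosed_subset isClosed_closure
    (closure_minimal (Set.prod_mono Set.Ioo_subset_Icc_self Set.Ioo_subset_Icc_self)
      (isClosed_Icc.prod isClosed_Icc))

/-- An open subset of the unit square which is dense in it and leaves out a set of positive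
measure. -/
theorem exists_open_dense_small :
    ∃ V ⊆ unitSquare, IsOpen V ∧ unitSquare ⊆ closure V ∧ 0 < volume (unitSquare \ V) := by
  -- A countable dense set is null, so outer regularity puts it in an open set of area less than
  -- that of the square.
  obtain ⟨S, hSc, hSd⟩ := TopologicalSpace.exists_countable_dense (ℝ × ℝ)
  obtain ⟨U, hSU, hU, hU1⟩ := S.exists_isOpen_lt_of_lt (μ := volume) 1
    (by rw [hSc.measure_zero]; exact one_pos)
  refine ⟨unitSquare ∩ U, Set.inter_subset_left, isOpen_unitSquare.inter hU,
    (hSd.mono hSU).open_subset_closure_inter isOpen_unitSquare, ?_⟩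
  rw [Set.sdiff_self_inter]
  have h := le_measure_sdiff (μ := volume) (s₁ := unitSquare) (s₂ := U)
  rw [volume_unitSquare] at h
  exact (tsub_pos_of_lt hU1).trans_le h

/-- A nonempty proper open set `V` is filled up to a null set by a packing of closed balls, each
at distance at least its radius from the complement of `V`. -/
theorem exists_packing {V : Set (ℝ × ℝ)} (hV : IsOpen V) (hVc : Vᶜ.Nonempty) :
    ∃ (t : Set (ℝ × ℝ)) (r : ℝ × ℝ → ℝ), IsBallPacking t r ∧
      (∀ c ∈ t, ∀ x ∉ V, 2 * r c < dist c x) ∧ volume (V \ packedUnion t r) = 0 := by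
  have hpos : ∀ x ∈ V, 0 < Metric.infDist x Vᶜ / 2 := fun x hx =>
    half_pos ((hV.isClosed_compl.notMem_iff_infDist_pos hVc).1 fun h => h hx)
  obtain ⟨t, r, htc, htV, htr, htμ, htd⟩ := Besicovitch.exists_disjoint_closedBall_covering_ae
    volume (fun _ => Set.univ) V
    (fun x _ δ hδ => ⟨δ / 2, trivial, half_pos hδ, half_lt_self hδ⟩) _ hpos
  refine ⟨t, r, ⟨htc, fun c hc => (htr c hc).2.1, htd⟩, fun c hc x hx => ?_, ?_⟩
  · have h1 := (htr c hc).2.2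
    have h2 := Metric.infDist_le_dist_of_mem (x := c) (show x ∈ Vᶜ from hx)
    linarith
  · rwa [packedUnion, Set.iUnion_coe_set]

theorem mem_branchSet_packedSqueeze {a : ℝ} {t : Set (ℝ × ℝ)} {r : ℝ × ℝ → ℝ}
    (ht : IsBallPacking t r) {X V : Set (ℝ × ℝ)} (hV : IsOpen V) (hXV : X ⊆ closure V)
    (hr : ∀ c ∈ t, ∀ x ∉ V, 2 * r c < dist c x) (hμ : volume (V \ packedUnion t r) = 0)
    {x : ℝ × ℝ} (hx : x ∈ X) (hxV : x ∉ V) : x ∈ branchSet X (packedSqueeze a t r) := by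
  refine ⟨hx, ?_⟩
  rintro ⟨U, hU, hxU, -, hemb⟩
  obtain ⟨ε, hε, hεU⟩ := Metric.isOpen_iff.1 hU x hxU
  -- If the ball about `c` meets `ball x (ε / 3)`, then `2 * r c < dist c x < r c + ε / 3` gives `r
  -- c < ε / 3`, so the whole ball lies within `ε` of `x`.
  have hne : (Metric.ball x (ε / 3) ∩ V).Nonempty :=
    mem_closure_iff.1 (hXV hx) _ Metric.isOpen_ball (Metric.mem_ball_self (by positivity))
  obtain ⟨w, ⟨hwx, hwV⟩, hwt⟩ : ∃ w ∈ Metric.ball x (ε / 3) ∩ V, w ∈ packedUnion t r := by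
    by_contra! h
    exact ((Metric.isOpen_ball.inter hV).measure_pos volume hne).ne'
      (measure_mono_null (t := V \ packedUnion t r) (fun w hw => ⟨hw.2, h w hw⟩) hμ)
  obtain ⟨⟨c, hc⟩, hwc⟩ := Set.mem_iUnion.1 hwt
  simp only [Metric.mem_closedBall, Metric.mem_ball] at hwc hwx
  have h1 := hr c hc x hxV
  have h2 := dist_triangle c w x
  rw [dist_comm c w] at h2
  have hsub : scaleMap c (r c) '' collapsedSegment ⊆ U := by
    refine (segment_subset_closedBall c (ht.pos c hc)).trans fun b hb => hεU ?_
    rw [Metric.mem_closedBall] at hb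
    rw [Metric.mem_ball]
    have h3 := dist_triangle b c x
    linarith
  have hmem : ∀ s ∈ Set.Icc (-(1 / 2) : ℝ) (1 / 2),
      scaleMap c (r c) (s, 0) ∈ scaleMap c (r c) '' collapsedSegment :=
    fun s hs => Set.mem_image_of_mem _ ⟨hs, rfl⟩
  have m0 := hmem 0 (by norm_num)
  have m1 := hmem (1 / 2) (by norm_num)
  have heq := hemb.injective (a₁ := ⟨_, hsub m0⟩) (a₂ := ⟨_, hsub m1⟩)
    ((packedSqueeze_of_mem_segment ht hc m0).trans (packedSqueeze_of_mem_segment ht hc m1).symm)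
  have := congrArg Prod.fst (scaleMap_injective c (ht.pos c hc) (Subtype.ext_iff.1 heq))
  norm_num at this

theorem isSobolevMap_packedSqueeze {p q a : ℝ} {t : Set (ℝ × ℝ)} {r : ℝ × ℝ → ℝ} (hp : 1 ≤ p)
    (ha : 0 < a) (ha' : a < 1) (ht : IsBallPacking t r) {X : Set (ℝ × ℝ)} (hXm : MeasurableSet X)
    (hXc : IsCompact (closure X)) (hX : ∀ c ∈ t, Metric.closedBall c (r c) ⊆ X)
    (hE : neohookeanEnergy p q X (packedSqueezeDeriv a t r) < ⊤) :
    IsSobolevMap p X (packedSqueeze a t r) (packedSqueezeDeriv a t r) := by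
  have hXv : volume X ≠ ⊤ := measure_ne_top_of_subset subset_closure hXc.measure_lt_top.ne
  have : IsFiniteMeasure (volume.restrict X) := isFiniteMeasure_restrict.2 hXv
  have hcont := continuous_packedSqueeze ha ht hXv hX
  have hp0 : 0 < p := by linarith
  have hh : ∀ i q', MemLp (fun x => coordFun i (packedSqueeze a t r x)) q' (volume.restrict X) := by
    intro i q'
    have hc : Continuous fun x => coordFun i (packedSqueeze a t r x) :=
      (continuous_coordFun i).comp hcont
    obtain ⟨C, hC⟩ := hXc.exists_bound_of_continuousOn hc.continuousOn
    exact MemLp.of_bound hc.aestronglyMeasurable C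
      ((ae_restrict_mem hXm).mono fun x hx => hC x (subset_closure hx))
  have hD : ∀ i j, MemLp (fun x => packedSqueezeDeriv a t r x i j) (ENNReal.ofReal p)
      (volume.restrict X) := by
    intro i j
    refine ⟨(aestronglyMeasurable_packedSqueezeDeriv ha ht i j).restrict, ?_⟩
    rw [eLpNorm_lt_top_iff_lintegral_rpow_enorm_lt_top (by simpa using hp0) ENNReal.ofReal_ne_top,
      ENNReal.toReal_ofReal hp0.le]
    refine (lintegral_mono fun x => ?_).trans_lt hE
    refine le_trans ?_ le_self_add
    rw [Real.enorm_eq_ofReal_abs, ENNReal.ofReal_rpow_of_nonneg (abs_nonneg _) hp0.le]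
    exact ENNReal.ofReal_le_ofReal
      (Real.rpow_le_rpow (abs_nonneg _) (abs_le_hilbertSchmidt _ i j) hp0.le)
  refine ⟨fun i => hh i _, hD, fun i j => ?_⟩
  exact hasWeakPartialDeriv_packedSqueeze ha ha' ht hX i j hXm ((hh i 1).integrable le_rfl) hcont
    ((hD i j).integrable (by simpa using hp))

/-- The determinant term is infinite wherever the determinant is not positive, so finite energy
already forces the sign. -/
theorem ae_det_nonneg_of_energy_lt_top {p q : ℝ} (hq : 0 < q) {X : Set (ℝ × ℝ)}
    {D : ℝ × ℝ → Matrix (Fin 2) (Fin 2) ℝ}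
    (hD : ∀ i j, AEStronglyMeasurable (fun x => D x i j) (volume.restrict X))
    (hE : neohookeanEnergy p q X D < ⊤) : ∀ᵐ x ∂volume.restrict X, 0 ≤ (D x).det := by
  have hdet : AEMeasurable (fun x => (D x).det) (volume.restrict X) := by
    simp only [Matrix.det_fin_two]
    exact ((hD 0 0).aemeasurable.mul (hD 1 1).aemeasurable).sub
      ((hD 0 1).aemeasurable.mul (hD 1 0).aemeasurable)
  have hlt : ∫⁻ x in X, ENNReal.ofReal (D x).det ^ (-q) ≠ ⊤ :=
    ((lintegral_mono fun x => le_add_self).trans_lt hE).ne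
  filter_upwards [ae_lt_top' (hdet.ennreal_ofReal.pow_const _) hlt] with x hx
  by_contra! hneg
  rw [ENNReal.ofReal_of_nonpos hneg.le, ENNReal.zero_rpow_of_neg (by linarith)] at hx
  exact lt_irrefl _ hx

theorem exists_exponent {p q : ℝ} (hp : 2 < p) (hq : 0 < q) (hqp : q < p / (p - 2)) :
    ∃ a : ℝ, 1 / 2 ≤ a ∧ a < 1 ∧ -1 < (a - 1) * p ∧ -1 < (2 * a - 1) * -q := by
  have hp0 : 0 < p := by linarith
  -- The lower bound on `a` comes from the `p`-integrability of `|y| ^ (a - 1)`, the upper one from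
  -- the `q`-integrability of the inverse Jacobian; `p > 2` puts the lower bound above `1 / 2`.
  have hlt : 1 - 1 / p < min 1 ((1 + 1 / q) / 2) := by
    refine lt_min (by have := one_div_pos.2 hp0; linarith) ?_
    rw [lt_div_iff₀ (by linarith)] at hqp
    have h : 1 - 2 / p < 1 / q := by
      rw [lt_div_iff₀ hq, one_sub_div hp0.ne', div_mul_eq_mul_div, div_lt_one hp0]
      linarith
    have : 2 / p = 2 * (1 / p) := by ring
    linarith
  obtain ⟨a, ha1, ha2⟩ := exists_between hlt
  obtain ⟨ha2, ha3⟩ := lt_min_iff.1 ha2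
  have hp2 : 1 / p < 1 / 2 := one_div_lt_one_div_of_lt two_pos hp
  refine ⟨a, by linarith, ha2, ?_, ?_⟩
  · have : 1 / p * p = 1 := by field_simp
    nlinarith
  · have : 1 / q * q = 1 := by field_simp
    nlinarith

theorem mainTheorem6 (p q : ℝ) (hp : 2 < p) (hq : 0 < q) (hqp : q < p / (p - 2)) :
    ∃ (h : ℝ × ℝ → ℝ × ℝ) (Dh : ℝ × ℝ → Matrix (Fin 2) (Fin 2) ℝ),
      IsMonotoneSobolev p unitSquare unitSquare h Dh ∧
      neohookeanEnergy p q unitSquare Dh < ⊤ ∧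
      0 < MeasureTheory.volume (branchSet unitSquare h) ∧
      0 < MeasureTheory.volume (h '' branchSet unitSquare h) := by
  obtain ⟨a, ha, ha1, hap, haq⟩ := exists_exponent hp hq hqp
  have ha0 : 0 < a := by linarith
  obtain ⟨V, hVX, hV, hdense, hpos⟩ := exists_open_dense_small
  obtain ⟨x₀, hx₀⟩ := nonempty_of_measure_ne_zero hpos.ne'
  obtain ⟨t, r, ht, hr, hμ⟩ := exists_packing hV ⟨x₀, hx₀.2⟩
  have hballV : ∀ c ∈ t, Metric.closedBall c (r c) ⊆ V := by
    intro c hc x hx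
    by_contra hxV
    have h1 := hr c hc x hxV
    have h2 := ht.pos c hc
    rw [Metric.mem_closedBall'] at hx
    linarith
  have hballX : ∀ c ∈ t, Metric.closedBall c (r c) ⊆ unitSquare := fun c hc =>
    (hballV c hc).trans hVX
  have hE := neohookeanEnergy_packedSqueezeDeriv_lt_top ht
    (volume_unitSquare.trans_ne ENNReal.one_ne_top) hballX
    (neohookeanEnergy_squeezeDeriv_lt_top (by linarith) hq ha ha1 hap haq)
  have hbranch : unitSquare \ V ⊆ branchSet unitSquare (packedSqueeze a t r) := fun x hx =>
    mem_branchSet_packedSqueeze ht hV hdense hr hμ hx.1 hx.2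
  refine ⟨packedSqueeze a t r, packedSqueezeDeriv a t r, ⟨?_, ?_, ?_⟩, hE,
    hpos.trans_le (measure_mono hbranch), hpos.trans_le (measure_mono fun x hx => ?_)⟩
  · exact isMonotoneOnto_packedSqueeze ha0 ht isCompact_closure_unitSquare fun c hc =>
      (hballX c hc).trans subset_closure
  · exact isSobolevMap_packedSqueeze (by linarith) ha0 ha1 ht isOpen_unitSquare.measurableSet
      isCompact_closure_unitSquare hballX hE
  · exact ae_det_nonneg_of_energy_lt_top hq
      (fun i j => (aestronglyMeasurable_packedSqueezeDeriv ha0 ht i j).restrict) hE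
  · exact ⟨x, hbranch hx, packedSqueeze_of_notMem fun c hc hxc => hx.2 (hballV c hc hxc)⟩
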